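/- Let $\mathcal X\subset\mathbb R^k$ and $\mathcal Y\subset\mathbb R$ be measurable, $\epsilon>0$, $l<u$, $t(y)=\min(\max(y,l),u)$, $C_\epsilon=\frac{e^\epsilon+1}{e^\epsilon-1}$, and let the bit flip be $\mathrm{bf}(1\mid v)=\frac12+\frac{v-(u+l)/2}{(u-l)C_\epsilon}$, $\mathrm{bf}(0\mid v)=1-\mathrm{bf}(1\mid v)$ for $v\in[l,u]$. Users $i=1,2,\dots$ independently obtain $X_i\sim F_X$ on $\mathcal X$, generate $Y_i\sim F(\cdot\mid X_i)$ on $\mathcal Y$, and submit one bit $Z_i\in\{0,1\}$ drawn from $\mathrm{bf}(\cdot\mid t(Y_i))$. Let $P$ be the law of $(X_i,Z_i)$. Let $\mathcal B\subset\mathbb R^d$ be compact and let $\{F_\beta(\cdot\mid x)\}_{\beta\in\mathcal B}$ be a family of conditional distributions on $\mathcal Y$ given $x\in\mathcal X$. Put $$p_\beta(z\mid x)=\int \mathrm{bf}(z\mid t(y))\,dF_\beta(y\mid x),\qquad \Lambda_\epsilon(\beta,x)=p_\beta(1\mid x),\qquad p_\beta(x,z)=p_\beta(z\mid x)f_X(x),$$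 where $f_X$ is introduced in 2 below, and let $\Lambda_\epsilon',\Lambda_\epsilon''$ be the gradient and Hessian of $\Lambda_\epsilon$ in $\beta$, taken at interior points of $\mathcal B$. Assume: 1. for some measure $\nu$ on $\mathcal Y$, $F(\cdot\mid x)$ has for every $x$ a density with respect to $\nu$ that is measurable in $y$; 2. $F_X$ has a measurable density $f_X$ with respect to some measure on $\mathcal X$, and $\log f_X$ is $F_X$-integrable; 3. for all $\beta\in\mathcal B$ and $x\in\mathcal X$, $F_\beta(\cdot\mid x)$ has a density $f_\beta(y\mid x)$ with respect to $\nu$ that is measurable in $y$, and $f_\beta(y\mid x)$ is continuous in $\beta\in\mathcal B$ for every $x,y$; 4. $\beta\mapsto P\log p_\beta=\int\log p_\beta\,dP$ has a unique maximizer $\beta^*$ over $\mathcal B$, and $\beta^*$ is an interior point of $\mathcal B$; 5. on the interior of $\mathcal B$, $\Lambda_\epsilon'(\beta,x)$ exists, is measurable in $x$ for each $\beta$ and continuously differentiable in $\beta$ for each $x$; 6. the absolute value of each entry of $\Lambda_\epsilon'(\beta,x)$ and of $\Lambda_\epsilon''(\beta,x)$ is bounded, for all interior $\beta$ and all $x$,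 by a $P$-integrable function not depending on $\beta$; 7. $F_X\,\Lambda_\epsilon'(\beta^*,X)\Lambda_\epsilon'(\beta^*,X)^\top$ is nonsingular; 8. $A(\beta^*)$ is nonsingular, where $$A(\beta)=P\,\frac{\partial^2\log p_\beta}{\partial\beta^2},\qquad B(\beta)=P\Big(\frac{\partial\log p_\beta}{\partial\beta}\Big)\Big(\frac{\partial\log p_\beta}{\partial\beta}\Big)^{\!\top}.$$ Let $\hat\beta_n$ be a (measurable) maximizer over $\beta\in\mathcal B$ of $\ell(\beta;D_n)=\frac1n\sum_{i=1}^n\log p_\beta(X_i,Z_i)$. Then the entries defining $A(\beta^*)$ and $B(\beta^*)$ are $P$-integrable, $C(\beta^*)=A(\beta^*)^{-1}B(\beta^*)A(\beta^*)^{-1}$ is positive semidefinite, and $$\sqrt n\,(\hat\beta_n-\beta^*)\;\longrightarrow\;\mathcal N\big(0,\,C(\beta^*)\big)\quad\text{in distribution as } n\to\infty .$$ -/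

import Mathlib

open MeasureTheory ProbabilityTheory Filter Topology
open scoped NNReal ENNReal

namespace BitLDP

noncomputable section

/-- Truncation of `y` to the interval `[l, u]`. -/
def truncate (l u y : ℝ) : ℝ :=
  if y ≤ l then l else if y < u then y else u

/-- The constant `C_ε = (e^ε + 1) / (e^ε - 1)`. -/
def flipConst (ε : ℝ) : ℝ := (Real.exp ε + 1) / (Real.exp ε - 1)

/-- The bit flip: the probability of reporting the bit `z` on input `v ∈ [l, u]`.
The bit `true` is `z₊ = 1` and the bit `false` is `z₋ = 0`. -/
def bitFlip (ε l u : ℝ) (z : Bool) (v : ℝ) : ℝ :=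
  match z with
  | false => 1 / 2 - (v - (u + l) / 2) / ((u - l) * flipConst ε)
  | true => 1 / 2 + (v - (u + l) / 2) / ((u - l) * flipConst ε)

theorem measurable_truncate (l u : ℝ) : Measurable (truncate l u) := by
  unfold truncate
  exact Measurable.ite measurableSet_Iic measurable_const
    (Measurable.ite measurableSet_Iio measurable_id measurable_const)

theorem measurable_bitFlip (ε l u : ℝ) (z : Bool) : Measurable (bitFlip ε l u z) := by
  cases z <;> (unfold bitFlip; fun_prop)

theorem truncate_mem {l u : ℝ} (hlu : l < u) (y : ℝ) :
    l ≤ truncate l u y ∧ truncate l u y ≤ u := by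
  unfold truncate
  split_ifs <;> constructor <;> linarith

theorem bitFlip_mem {ε l u : ℝ} (hε : 0 < ε) (hlu : l < u) (z : Bool) {v : ℝ}
    (hl : l ≤ v) (hu : v ≤ u) :
    1 / (Real.exp ε + 1) ≤ bitFlip ε l u z v ∧
      bitFlip ε l u z v ≤ Real.exp ε / (Real.exp ε + 1) := by
  have he : 1 < Real.exp ε := Real.one_lt_exp_iff.2 hε
  have h1 : (0 : ℝ) < Real.exp ε - 1 := by linarith
  have h2 : (0 : ℝ) < Real.exp ε + 1 := by linarith
  have h3 : 0 < u - l := by linarith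
  have key : (v - (u + l) / 2) / ((u - l) * flipConst ε)
      = ((v - (u + l) / 2) / (u - l)) * ((Real.exp ε - 1) / (Real.exp ε + 1)) := by
    unfold flipConst
    field_simp
  have ha : (v - (u + l) / 2) / (u - l) ≤ 1 / 2 := by
    rw [div_le_iff₀ h3]; linarith
  have hb : -(1 / 2) ≤ (v - (u + l) / 2) / (u - l) := by
    rw [le_div_iff₀ h3]; linarith
  have hr : 0 ≤ (Real.exp ε - 1) / (Real.exp ε + 1) := by positivity
  have e1 : 1 / (Real.exp ε + 1)
      = 1 / 2 - 1 / 2 * ((Real.exp ε - 1) / (Real.exp ε + 1)) := by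
    field_simp; ring
  have e2 : Real.exp ε / (Real.exp ε + 1)
      = 1 / 2 + 1 / 2 * ((Real.exp ε - 1) / (Real.exp ε + 1)) := by
    field_simp; ring
  rw [e1, e2]
  cases z <;> simp only [bitFlip] <;> rw [key] <;> constructor <;> nlinarith

variable {k d : ℕ} {𝒳 : Set (EuclideanSpace ℝ (Fin k))} {𝒴 : Set ℝ}

/-- The randomized report of a user: on response `y`, truncate it to `[l, u]` and draw one bit
from the bit flip. -/
def reportKernel (ε l u : ℝ) (𝒴 : Set ℝ) : Kernel 𝒴 Bool where
  toFun y :=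
    ENNReal.ofReal (bitFlip ε l u false (truncate l u y)) • Measure.dirac false +
      ENNReal.ofReal (bitFlip ε l u true (truncate l u y)) • Measure.dirac true
  measurable' := by
    have h (z : Bool) : Measurable fun y : 𝒴 =>
        ENNReal.ofReal (bitFlip ε l u z (truncate l u y)) :=
      ((measurable_bitFlip ε l u z).comp
        ((measurable_truncate l u).comp measurable_subtype_coe)).ennreal_ofReal
    refine Measure.measurable_of_measurable_coe _ fun s _ => ?_
    simp only [Measure.coe_add, Measure.coe_smul, Pi.add_apply, Pi.smul_apply, smul_eq_mul]
    exact ((h false).mul_const _).add ((h true).mul_const _)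

theorem isMarkovKernel_reportKernel {ε l u : ℝ} (hε : 0 < ε) (hlu : l < u) (𝒴 : Set ℝ) :
    IsMarkovKernel (reportKernel ε l u 𝒴) := by
  refine ⟨fun y => ⟨?_⟩⟩
  obtain ⟨h1, h2⟩ := truncate_mem hlu (y : ℝ)
  have h3 : (0 : ℝ) ≤ 1 / (Real.exp ε + 1) := by positivity
  have hf := (bitFlip_mem hε hlu false h1 h2).1
  have ht := (bitFlip_mem hε hlu true h1 h2).1
  change (ENNReal.ofReal (bitFlip ε l u false (truncate l u y)) • Measure.dirac false +
      ENNReal.ofReal (bitFlip ε l u true (truncate l u y)) • Measure.dirac true) Set.univ = 1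
  simp only [Measure.coe_add, Measure.coe_smul, Pi.add_apply, Pi.smul_apply, smul_eq_mul,
    measure_univ, mul_one]
  rw [← ENNReal.ofReal_add (h3.trans hf) (h3.trans ht)]
  simp [bitFlip]
  norm_num

/-- The law of the triple `(X, Y, Z)` of one user: `X ∼ F_X`, then `Y ∼ F(· | X)`, then the
submitted bit `Z` is drawn by the bit flip from the truncation of `Y`. -/
def userLaw (ε l u : ℝ) (FX : Measure 𝒳) (F : Kernel 𝒳 𝒴) : Measure (𝒳 × 𝒴 × Bool) :=
  FX ⊗ₘ (F ⊗ₖ Kernel.prodMkLeft 𝒳 (reportKernel ε l u 𝒴))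

/-- The law `P` of the pair `(X, Z)` that the curator sees. -/
def obsLaw (ε l u : ℝ) (FX : Measure 𝒳) (F : Kernel 𝒳 𝒴) : Measure (𝒳 × Bool) :=
  (userLaw ε l u FX F).map fun w => (w.1, w.2.2)

/-- The conditional probability `p(z | x) = ∫ bitFlip(z | t(y)) dF(y | x)` of the bit. -/
def bitProb (ε l u : ℝ) (F : Kernel 𝒳 𝒴) (z : Bool) (x : 𝒳) : ℝ :=
  ∫ y, bitFlip ε l u z (truncate l u y) ∂(F x)

/-- `Λ_ε(β, x) = p_β(1 | x)`. -/
def Lam (ε l u : ℝ) (Fm : EuclideanSpace ℝ (Fin d) → Kernel 𝒳 𝒴)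
    (β : EuclideanSpace ℝ (Fin d)) (x : 𝒳) : ℝ :=
  bitProb ε l u (Fm β) true x

/-- `log p_β(x, z)`, where `p_β(x, z) = p_β(z | x) f_X(x)` is the joint model density. -/
def logDensity (ε l u : ℝ) (fX : 𝒳 → ℝ≥0) (Fm : EuclideanSpace ℝ (Fin d) → Kernel 𝒳 𝒴)
    (β : EuclideanSpace ℝ (Fin d)) (w : 𝒳 × Bool) : ℝ :=
  Real.log (bitProb ε l u (Fm β) w.2 w.1 * fX w.1)

/-- The log-likelihood `ℓ(β; D_n) = (1 / n) ∑ i < n, log p_β(x_i, z_i)`. -/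
def logLik (ε l u : ℝ) (fX : 𝒳 → ℝ≥0) (Fm : EuclideanSpace ℝ (Fin d) → Kernel 𝒳 𝒴)
    (n : ℕ) (D : ℕ → 𝒳 × Bool) (β : EuclideanSpace ℝ (Fin d)) : ℝ :=
  (1 / (n : ℝ)) * ∑ i ∈ Finset.range n, logDensity ε l u fX Fm β (D i)

/-- The partial derivative `∂g / ∂β_j`. -/
def pderiv (j : Fin d) (g : EuclideanSpace ℝ (Fin d) → ℝ) (β : EuclideanSpace ℝ (Fin d)) : ℝ :=
  fderiv ℝ g β (EuclideanSpace.single j 1)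

/-- `∂ log p_β(w) / ∂β_i`. -/
def score (ε l u : ℝ) (fX : 𝒳 → ℝ≥0) (Fm : EuclideanSpace ℝ (Fin d) → Kernel 𝒳 𝒴)
    (β : EuclideanSpace ℝ (Fin d)) (i : Fin d) (w : 𝒳 × Bool) : ℝ :=
  pderiv i (fun b => logDensity ε l u fX Fm b w) β

/-- `∂² log p_β(w) / ∂β_i ∂β_j`. -/
def hess (ε l u : ℝ) (fX : 𝒳 → ℝ≥0) (Fm : EuclideanSpace ℝ (Fin d) → Kernel 𝒳 𝒴)
    (β : EuclideanSpace ℝ (Fin d)) (i j : Fin d) (w : 𝒳 × Bool) : ℝ :=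
  pderiv i (pderiv j fun b => logDensity ε l u fX Fm b w) β

/-- The expected Hessian `A(β) = P ∂² log p_β / ∂β²`. -/
def matA (ε l u : ℝ) (FX : Measure 𝒳) (F : Kernel 𝒳 𝒴) (fX : 𝒳 → ℝ≥0)
    (Fm : EuclideanSpace ℝ (Fin d) → Kernel 𝒳 𝒴) (β : EuclideanSpace ℝ (Fin d)) :
    Matrix (Fin d) (Fin d) ℝ :=
  Matrix.of fun i j => ∫ w, hess ε l u fX Fm β i j w ∂(obsLaw ε l u FX F)

/-- The expected outer product of the score,
`B(β) = P (∂ log p_β / ∂β) (∂ log p_β / ∂β)ᵀ`. -/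
def matB (ε l u : ℝ) (FX : Measure 𝒳) (F : Kernel 𝒳 𝒴) (fX : 𝒳 → ℝ≥0)
    (Fm : EuclideanSpace ℝ (Fin d) → Kernel 𝒳 𝒴) (β : EuclideanSpace ℝ (Fin d)) :
    Matrix (Fin d) (Fin d) ℝ :=
  Matrix.of fun i j =>
    ∫ w, score ε l u fX Fm β i w * score ε l u fX Fm β j w ∂(obsLaw ε l u FX F)

/-- The asymptotic covariance `C(β) = A(β)⁻¹ B(β) A(β)⁻¹`. -/
def matC (ε l u : ℝ) (FX : Measure 𝒳) (F : Kernel 𝒳 𝒴) (fX : 𝒳 → ℝ≥0)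
    (Fm : EuclideanSpace ℝ (Fin d) → Kernel 𝒳 𝒴) (β : EuclideanSpace ℝ (Fin d)) :
    Matrix (Fin d) (Fin d) ℝ :=
  (matA ε l u FX F fX Fm β)⁻¹ * matB ε l u FX F fX Fm β * (matA ε l u FX F fX Fm β)⁻¹

end

end BitLDP

/-! The estimator is an M-estimator with criterion `log p_β(x, z)`, and the argument is the
classical one. A uniform law of large numbers over the compact parameter set, together with the
unique maximum, gives strong consistency (`tendsto_argmax`). Once the estimator is close to the
interior point `βs`, the empirical score vanishes there, and a first-order expansion of that score
shows that `√n (βhat - βs)` is close to the normalized sum of the influence functions `-A⁻¹ ∂ log p`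
(`eventually_norm_sub_influence_le`). These are centered, because `βs` maximizes the expected
criterion, and their second moment matrix is `A⁻¹ B A⁻¹`, because `A` is symmetric; the central
limit theorem finishes (`asymptoticNormality_argmax`).

The expansion error is small only relative to `√n (βhat - βs)` itself. No tightness has to be known
beforehand: `tendstoInDistribution_of_norm_sub_le` turns this relative bound into equality of
limits.

The model enters through three facts. The flip keeps every bit probability at least `1 / (e^ε + 1)`,
so dividing by it or taking its logarithm costs a constant. Continuity in `β` over the whole
parameter set follows from pointwise continuity of the densities by Fatou's lemma, applied to both
bits (`continuousOn_bitProb`). Finally, the Hessian of `log p_β` and the matrix `B` contain products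
of first derivatives of `Λ_ε`, while only the derivatives themselves are assumed dominated. Since
`Λ_ε` takes values in `[0, 1]`, Landau's inequality (`sq_pderiv_le`) bounds the squared first
derivatives by the envelope of the second ones, which supplies the missing integrability. -/

namespace BitLDP

/-! ### Second moment matrices and the multivariate central limit theorem. -/

/-- The quadratic form of the second moment matrix. -/
theorem integral_sq_inner {d : ℕ} {W : Type*} [MeasurableSpace W] {P : Measure W}
    {S : Matrix (Fin d) (Fin d) ℝ} {η : W → EuclideanSpace ℝ (Fin d)}
    (hint : ∀ i j, Integrable (fun w => η w i * η w j) P)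
    (hS : ∀ i j, S i j = ∫ w, η w i * η w j ∂P) (x : Fin d → ℝ) :
    x ⬝ᵥ S.mulVec x = ∫ w, (∑ i, x i * η w i) ^ 2 ∂P := by
  simp only [sq, Finset.sum_mul_sum]
  rw [integral_finsetSum _ fun i _ => integrable_finsetSum _ fun j _ => by
    simpa only [mul_mul_mul_comm] using (hint i j).const_mul (x i * x j)]
  simp only [dotProduct, Matrix.mulVec, Finset.mul_sum]
  refine Finset.sum_congr rfl fun i _ => ?_
  rw [integral_finsetSum _ fun j _ => by
    simpa only [mul_mul_mul_comm] using (hint i j).const_mul (x i * x j)]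
  refine Finset.sum_congr rfl fun j _ => ?_
  simp only [mul_mul_mul_comm (x i) _ (x j) _]
  rw [integral_const_mul, hS]
  ring

/-- The matrix of second moments of a square-integrable random vector is positive semidefinite. -/
theorem posSemidef_of_integral_mul {d : ℕ} {W : Type*} [MeasurableSpace W] {P : Measure W}
    {S : Matrix (Fin d) (Fin d) ℝ} {η : W → EuclideanSpace ℝ (Fin d)}
    (hint : ∀ i j, Integrable (fun w => η w i * η w j) P)
    (hS : ∀ i j, S i j = ∫ w, η w i * η w j ∂P) : S.PosSemidef := by
  refine Matrix.PosSemidef.of_dotProduct_mulVec_nonneg ?_ fun x => ?_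
  · ext i j
    simp only [Matrix.conjTranspose_apply, star_trivial, hS, mul_comm]
  · rw [star_trivial, integral_sq_inner hint hS]
    exact integral_nonneg fun w => sq_nonneg _

/-- **Multivariate central limit theorem** for centered square-integrable random vectors. -/
theorem tendstoInDistribution_inv_sqrt_smul_sum {d : ℕ} {Ω : Type*} [MeasurableSpace Ω]
    {Pr : Measure Ω} [IsProbabilityMeasure Pr] {η : ℕ → Ω → EuclideanSpace ℝ (Fin d)}
    {S : Matrix (Fin d) (Fin d) ℝ}
    (hint : ∀ i j, Integrable (fun ω => η 0 ω i * η 0 ω j) Pr)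
    (hS : ∀ i j, S i j = ∫ ω, η 0 ω i * η 0 ω j ∂Pr)
    (hmean : ∀ i, ∫ ω, η 0 ω i ∂Pr = 0)
    (hindep : iIndepFun η Pr) (hident : ∀ n, IdentDistrib (η n) (η 0) Pr Pr) :
    TendstoInDistribution (fun (n : ℕ) ω => (√(n : ℝ))⁻¹ • ∑ k ∈ Finset.range n, η k ω) atTop id
      (fun _ => Pr) (multivariateGaussian 0 S) := by
  have hmeas n : AEMeasurable (η n) Pr := (hident n).aemeasurable_fst
  have hsum (n : ℕ) : AEMeasurable
      (fun ω => (√(n : ℝ))⁻¹ • ∑ k ∈ Finset.range n, η k ω) Pr :=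
    AEMeasurable.fun_const_smul (Finset.aemeasurable_fun_sum _ fun k _ => hmeas k) _
  have hPS : S.PosSemidef := posSemidef_of_integral_mul hint hS
  have hcoord i : AEMeasurable (fun ω => η 0 ω i) Pr := by
    have := hmeas 0
    fun_prop
  have hL2 i : MemLp (fun ω => η 0 ω i) 2 Pr := by
    rw [memLp_two_iff_integrable_sq (hcoord i).aestronglyMeasurable]
    simpa only [sq] using hint i i
  refine ⟨hsum, aemeasurable_id, ?_⟩
  refine ProbabilityMeasure.tendsto_iff_tendsto_charFun.2 fun t => ?_
  -- Cramér–Wold: the characteristic function of the vector sum at `t` is that of the projected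
  -- scalar sum at `1`, so the scalar theorem suffices.
  let φ : EuclideanSpace ℝ (Fin d) → ℝ := fun v => inner ℝ v t
  have hφ : Measurable φ := by fun_prop
  have hφs v : φ v = ∑ i, t i * v i := by
    simp [φ, PiLp.inner_apply]
  have hφint : ∫ ω, φ (η 0 ω) ∂Pr = 0 := by
    simp only [hφs]
    rw [integral_finsetSum _ fun i _ => ((hL2 i).integrable (by norm_num)).const_mul _]
    simp [integral_const_mul, hmean]
  have hφL2 : MemLp (fun ω => φ (η 0 ω)) 2 Pr := by
    simp only [hφs]
    exact memLp_finsetSum _ fun i _ => (hL2 i).const_mul _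
  have hvar : Var[fun ω => φ (η 0 ω); Pr] = t ⬝ᵥ S.mulVec t := by
    rw [variance_of_integral_eq_zero hφL2.1.aemeasurable hφint, integral_sq_inner hint hS]
    simp only [hφs]
  have hclt := tendstoInDistribution_inv_sqrt_mul_sum_sub (P := Pr)
    (P' := gaussianReal 0 Var[fun ω => φ (η 0 ω); Pr].toNNReal)
    (X := fun n ω => φ (η n ω)) (Y := id) HasLaw.id hφL2
    (hindep.comp (fun _ => φ) fun _ => hφ) fun n => (hident n).comp hφ
  have h1 := ProbabilityMeasure.tendsto_iff_tendsto_charFun.1 hclt.tendsto 1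
  simp only [hφint, mul_zero, sub_zero, ProbabilityMeasure.coe_mk, Measure.map_id] at h1 ⊢
  have hlim : charFun (multivariateGaussian 0 S) t
      = charFun (gaussianReal 0 Var[fun ω => φ (η 0 ω); Pr].toNNReal) 1 := by
    rw [charFun_multivariateGaussian hPS, charFun_gaussianReal, hvar]
    have h0 : 0 ≤ t ⬝ᵥ S.mulVec t := by
      rw [integral_sq_inner hint hS]; exact integral_nonneg fun _ => sq_nonneg _
    simp [Real.coe_toNNReal _ h0]
  rw [hlim]
  refine h1.congr fun n => ?_
  rw [charFun_apply, charFun_apply, integral_map (hsum n) (by fun_prop), integral_map _ (by fun_prop)]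
  · refine integral_congr_ae (ae_of_all _ fun ω => ?_)
    simp [φ, inner_smul_left, sum_inner]
  · exact AEMeasurable.const_mul (Finset.aemeasurable_fun_sum _ fun k _ =>
      hφ.comp_aemeasurable (hmeas k)) _

/-! ### Laws of large numbers and consistency. -/

section UniformLaw

variable {W Ω : Type*} [MeasurableSpace W] [MeasurableSpace Ω] {P : Measure W} {Pr : Measure Ω}
  {ξ : ℕ → Ω → W}

/-- Strong law of large numbers for a function of independent observations with law `P`. -/
theorem tendsto_average (hlaw : ∀ i, HasLaw (ξ i) P Pr) (hindep : iIndepFun ξ Pr) {φ : W → ℝ}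
    (hφ : Measurable φ) (hint : Integrable φ P) :
    ∀ᵐ ω ∂Pr, Tendsto (fun n : ℕ => 1 / (n : ℝ) * ∑ i ∈ Finset.range n, φ (ξ i ω)) atTop
      (𝓝 (∫ w, φ w ∂P)) := by
  have hid i : IdentDistrib (ξ i) (ξ 0) Pr Pr := (hlaw i).identDistrib (hlaw 0)
  have hmean : ∫ ω, φ (ξ 0 ω) ∂Pr = ∫ w, φ w ∂P :=
    (hlaw 0).integral_comp hφ.aestronglyMeasurable
  have hint' : Integrable (fun ω => φ (ξ 0 ω)) Pr := by
    have := hint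
    rw [← (hlaw 0).map_eq] at this
    exact this.comp_aemeasurable (hlaw 0).aemeasurable
  have h := strong_law_ae (μ := Pr) (fun i ω => φ (ξ i ω)) hint'
    (fun i j hij => (hindep.indepFun hij).comp hφ hφ) fun i => (hid i).comp hφ
  rw [hmean] at h
  simpa only [one_div, smul_eq_mul] using h

/-- A local uniform law of large numbers: near `β₀`, the empirical means of a dominated family
that is continuous in the parameter stay close to the mean at `β₀`. -/
theorem exists_eventually_forall_average_sub_lt [IsProbabilityMeasure P]
    {E : Type*} [PseudoMetricSpace E] [SecondCountableTopology E]
    (hlaw : ∀ i, HasLaw (ξ i) P Pr) (hindep : iIndepFun ξ Pr)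
    {K : Set E} {β₀ : E} (hβ₀ : β₀ ∈ K) {g : E → W → ℝ} (hmeas : ∀ β ∈ K, Measurable (g β))
    (hcont : ∀ w, ContinuousOn (fun β => g β w) K) {h : W → ℝ} (hint : Integrable h P)
    (hdom : ∀ β ∈ K, ∀ w, |g β w| ≤ h w) {ε : ℝ} (hε : 0 < ε) :
    ∃ δ > 0, ∀ᵐ ω ∂Pr, ∀ᶠ n : ℕ in atTop, ∀ β ∈ K, dist β β₀ < δ →
      |1 / (n : ℝ) * ∑ i ∈ Finset.range n, g β (ξ i ω) - ∫ w, g β₀ w ∂P| < ε := by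
  let S : ℕ → Set E := fun k => K ∩ Metric.ball β₀ (1 / ((k : ℝ) + 1))
  have hS k : β₀ ∈ S k := ⟨hβ₀, Metric.mem_ball_self Nat.one_div_pos_of_nat⟩
  have : ∀ k, Nonempty (S k) := fun k => ⟨⟨β₀, hS k⟩⟩
  -- Taking the oscillation over a countable dense set keeps the supremum `m k` measurable.
  let D : ∀ k, ℕ → S k := fun k => TopologicalSpace.denseSeq (S k)
  let m : ℕ → W → ℝ := fun k w => ⨆ n, |g (D k n) w - g β₀ w|
  have hb k (s : S k) w : |g s w - g β₀ w| ≤ 2 * h w := by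
    have h1 := hdom s s.2.1 w
    have h2 := hdom β₀ hβ₀ w
    have := abs_sub (g s w) (g β₀ w)
    linarith
  have hbdd k w : BddAbove (Set.range fun n => |g (D k n) w - g β₀ w|) :=
    ⟨2 * h w, by rintro _ ⟨n, rfl⟩; exact hb k _ w⟩
  have hm_meas k : Measurable (m k) := by
    refine Measurable.iSup fun n => ?_
    have h1 := hmeas _ (D k n).2.1
    have h2 := hmeas _ hβ₀
    fun_prop
  have hm_nonneg k w : 0 ≤ m k w := Real.iSup_nonneg fun _ => abs_nonneg _
  have hm_le k w : m k w ≤ 2 * h w := ciSup_le fun n => hb k _ w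
  have hm_int k : Integrable (m k) P := by
    refine (hint.const_mul 2).mono' (hm_meas k).aestronglyMeasurable (ae_of_all _ fun w => ?_)
    rw [Real.norm_of_nonneg (hm_nonneg k w)]
    exact hm_le k w
  -- Continuity in the parameter extends the bound from the dense sequence to the whole
  -- neighbourhood.
  have hle k (s : S k) w : |g s w - g β₀ w| ≤ m k w := by
    have hc : Continuous fun s : S k => |g s w - g β₀ w| := by
      have := (hcont w).mono (Set.inter_subset_left (s := K)
        (t := Metric.ball β₀ (1 / ((k : ℝ) + 1))))
      have h2 : Continuous fun s : S k => g s w := continuousOn_iff_continuous_domRestrict.1 this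
      exact (h2.sub continuous_const).abs
    exact (TopologicalSpace.denseRange_denseSeq (S k)).induction_on
      (p := fun s : S k => |g s w - g β₀ w| ≤ m k w) s (isClosed_le hc continuous_const)
      fun n => le_ciSup (hbdd k w) n
  have hm_lim w : Tendsto (fun k => m k w) atTop (𝓝 0) := by
    rw [Metric.tendsto_atTop]
    intro η hη
    obtain ⟨δ, hδ, h1⟩ := Metric.continuousWithinAt_iff.1 (hcont w β₀ hβ₀) (η / 2) (half_pos hη)
    obtain ⟨N, hN⟩ := exists_nat_one_div_lt hδ
    refine ⟨N, fun k hk => ?_⟩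
    rw [Real.dist_0_eq_abs, abs_of_nonneg (hm_nonneg k w)]
    refine lt_of_le_of_lt (ciSup_le fun n => ?_) (half_lt_self hη)
    refine (h1 (D k n).2.1 ?_).le
    exact (lt_of_lt_of_le (D k n).2.2 (Nat.one_div_le_one_div hk)).trans hN
  have hmint : Tendsto (fun k => ∫ w, m k w ∂P) atTop (𝓝 0) := by
    have := tendsto_integral_of_dominated_convergence (F := m) (f := fun _ => 0)
      (fun w => 2 * h w) (fun k => (hm_meas k).aestronglyMeasurable) (hint.const_mul 2)
      (fun k => ae_of_all _ fun w => by
        rw [Real.norm_of_nonneg (hm_nonneg k w)]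
        exact hm_le k w) (ae_of_all _ hm_lim)
    simpa using this
  -- Half of `ε` pays for the mean oscillation on the neighbourhood, the other half for the
  -- fluctuation at `β₀`.
  obtain ⟨k, hk⟩ := (hmint.eventually_lt_const (half_pos hε)).exists
  have hg_int : Integrable (g β₀) P :=
    hint.mono' (hmeas _ hβ₀).aestronglyMeasurable (ae_of_all _ fun w => hdom β₀ hβ₀ w)
  refine ⟨1 / ((k : ℝ) + 1), Nat.one_div_pos_of_nat, ?_⟩
  filter_upwards [tendsto_average hlaw hindep (hm_meas k) (hm_int k),
    tendsto_average hlaw hindep (hmeas _ hβ₀) hg_int] with ω h1 h2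
  filter_upwards [h1.eventually_lt_const hk,
    Metric.tendsto_nhds.1 h2 (ε / 2) (half_pos hε)] with n h3 h4 β hβ hd
  rw [Real.dist_eq] at h4
  have h5 : |1 / (n : ℝ) * ∑ i ∈ Finset.range n, g β (ξ i ω)
      - 1 / (n : ℝ) * ∑ i ∈ Finset.range n, g β₀ (ξ i ω)|
      ≤ 1 / (n : ℝ) * ∑ i ∈ Finset.range n, m k (ξ i ω) := by
    rw [← mul_sub, ← Finset.sum_sub_distrib, abs_mul, abs_of_nonneg (by positivity : 0 ≤ 1 / (n : ℝ))]
    gcongr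
    exact (Finset.abs_sum_le_sum_abs _ _).trans
      (Finset.sum_le_sum fun i _ => hle k ⟨β, hβ, hd⟩ _)
  have h6 := abs_sub_le (1 / (n : ℝ) * ∑ i ∈ Finset.range n, g β (ξ i ω))
    (1 / (n : ℝ) * ∑ i ∈ Finset.range n, g β₀ (ξ i ω)) (∫ w, g β₀ w ∂P)
  linarith

/-- **Strong consistency** of M-estimators over a compact parameter set. -/
theorem tendsto_argmax [IsProbabilityMeasure P]
    {E : Type*} [PseudoMetricSpace E] [SecondCountableTopology E]
    (hlaw : ∀ i, HasLaw (ξ i) P Pr) (hindep : iIndepFun ξ Pr)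
    {K : Set E} (hK : IsCompact K) {βs : E} (hβs : βs ∈ K) {m : E → W → ℝ}
    (hmeas : ∀ β ∈ K, Measurable (m β))
    (hcont : ∀ w, ContinuousOn (fun β => m β w) K) {h : W → ℝ} (hint : Integrable h P)
    (hdom : ∀ β ∈ K, ∀ w, |m β w| ≤ h w)
    (hmax : ∀ β ∈ K, β ≠ βs → ∫ w, m β w ∂P < ∫ w, m βs w ∂P)
    {βhat : ℕ → Ω → E} (hβhat : ∀ n : ℕ, ∀ᵐ ω ∂Pr, βhat n ω ∈ K ∧ ∀ β ∈ K,
      1 / (n : ℝ) * ∑ i ∈ Finset.range n, m β (ξ i ω) ≤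
        1 / (n : ℝ) * ∑ i ∈ Finset.range n, m (βhat n ω) (ξ i ω)) :
    ∀ᵐ ω ∂Pr, Tendsto (fun n => βhat n ω) atTop (𝓝 βs) := by
  have hm_int β (hβ : β ∈ K) : Integrable (m β) P :=
    hint.mono' (hmeas _ hβ).aestronglyMeasurable (ae_of_all _ fun w => hdom β hβ w)
  have key (k : ℕ) : ∀ᵐ ω ∂Pr, ∀ᶠ n : ℕ in atTop, dist (βhat n ω) βs < 1 / ((k : ℝ) + 1) := by
    let C := K \ Metric.ball βs (1 / ((k : ℝ) + 1))
    have hC : IsCompact C := hK.diff Metric.isOpen_ball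
    have hne β (hβ : β ∈ C) : β ≠ βs := by
      rintro rfl
      exact hβ.2 (Metric.mem_ball_self Nat.one_div_pos_of_nat)
    have hloc : ∀ β ∈ C, ∃ δ > 0, ∀ᵐ ω ∂Pr, ∀ᶠ n : ℕ in atTop, ∀ b ∈ K, dist b β < δ →
        1 / (n : ℝ) * ∑ i ∈ Finset.range n, m b (ξ i ω) <
          1 / (n : ℝ) * ∑ i ∈ Finset.range n, m βs (ξ i ω) := by
      intro β hβ
      have hgap := hmax β hβ.1 (hne β hβ)
      -- Half the gap: an error below `η` on each side still leaves the empirical criterion larger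
      -- at `βs`.
      set η := (∫ w, m βs w ∂P - ∫ w, m β w ∂P) / 2 with hη
      have hηpos : 0 < η := by rw [hη]; linarith
      obtain ⟨δ, hδ, h1⟩ := exists_eventually_forall_average_sub_lt hlaw hindep hβ.1 hmeas hcont
        hint hdom hηpos
      refine ⟨δ, hδ, ?_⟩
      filter_upwards [h1, tendsto_average hlaw hindep (hmeas _ hβs) (hm_int _ hβs)] with ω h2 h3
      filter_upwards [h2, Metric.tendsto_nhds.1 h3 η hηpos] with n h4 h5 b hb hd
      have h6 := (abs_lt.1 (h4 b hb hd)).2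
      rw [Real.dist_eq] at h5
      have h7 := (abs_lt.1 h5).1
      linarith
    -- Compactness leaves finitely many balls, hence a single null set and a single threshold for
    -- `n`.
    choose! δ hδ hδ' using hloc
    obtain ⟨t, htC, ht⟩ := hC.elim_nhds_subcover (fun β => Metric.ball β (δ β))
      fun β hβ => Metric.ball_mem_nhds β (hδ β hβ)
    have h1 : ∀ᵐ ω ∂Pr, ∀ β ∈ t, ∀ᶠ n : ℕ in atTop, ∀ b ∈ K, dist b β < δ β →
        1 / (n : ℝ) * ∑ i ∈ Finset.range n, m b (ξ i ω) <
          1 / (n : ℝ) * ∑ i ∈ Finset.range n, m βs (ξ i ω) :=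
      (ae_ball_iff t.countable_toSet).2 fun β hβ => hδ' β (htC β hβ)
    filter_upwards [h1, ae_all_iff.2 hβhat] with ω h2 h3
    filter_upwards [(Filter.eventually_all_finset t).2 h2] with n h4
    by_contra hcon
    have hmem : βhat n ω ∈ C := ⟨(h3 n).1, hcon⟩
    obtain ⟨β, hβt, hβ⟩ := Set.mem_iUnion₂.1 (ht hmem)
    exact (h4 β hβt _ (h3 n).1 hβ).not_ge ((h3 n).2 βs hβs)
  filter_upwards [ae_all_iff.2 key] with ω hω
  refine Metric.tendsto_nhds.2 fun η hη => ?_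
  obtain ⟨k, hk⟩ := exists_nat_one_div_lt hη
  filter_upwards [hω k] with n hn using hn.trans hk

end UniformLaw

/-! ### A Slutsky argument with relative error. -/

/-- If `T` differs from `U` by an asymptotically negligible fraction of `T`, then `T` has the same
limit in distribution as `U`. -/
theorem tendstoInDistribution_of_norm_sub_le {Ω Ω' E : Type*} [MeasurableSpace Ω]
    [MeasurableSpace Ω'] {Pr : Measure Ω} [IsProbabilityMeasure Pr] {Q : Measure Ω'}
    [IsProbabilityMeasure Q] [NormedAddCommGroup E] [NormedSpace ℝ E] [SecondCountableTopology E]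
    [MeasurableSpace E] [BorelSpace E] {U T : ℕ → Ω → E} {Z : Ω' → E}
    (hU : TendstoInDistribution U atTop Z (fun _ => Pr) Q) (hT : ∀ n, AEMeasurable (T n) Pr)
    (h : ∀ ε > 0, ∀ᵐ ω ∂Pr, ∀ᶠ n in atTop, ‖T n ω - U n ω‖ ≤ ε * ‖T n ω‖) :
    TendstoInDistribution T atTop Z (fun _ => Pr) Q := by
  have hU' := hU.forall_aemeasurable
  have hrel (ε : ℝ) (hε : 0 < ε) : ∀ᵐ ω ∂Pr, ∀ᶠ n in atTop, ‖T n ω - U n ω‖ ≤ ε * ‖U n ω‖ := by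
    -- The bound `1 / 2` absorbs `‖T‖` into `2 ‖U‖`; then `ε / 2` gives an error relative to `U`,
    -- whose limit is known.
    filter_upwards [h (min (1 / 2) (ε / 2)) (by positivity)] with ω hω
    filter_upwards [hω] with n hn
    have h1 : ‖T n ω - U n ω‖ ≤ 1 / 2 * ‖T n ω‖ :=
      hn.trans (mul_le_mul_of_nonneg_right (min_le_left _ _) (norm_nonneg _))
    have h2 : ‖T n ω - U n ω‖ ≤ ε / 2 * ‖T n ω‖ :=
      hn.trans (mul_le_mul_of_nonneg_right (min_le_right _ _) (norm_nonneg _))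
    have h3 : ‖T n ω‖ ≤ 2 * ‖U n ω‖ := by
      have := norm_sub_norm_le (T n ω) (U n ω)
      linarith
    calc _ ≤ ε / 2 * ‖T n ω‖ := h2
      _ ≤ ε / 2 * (2 * ‖U n ω‖) := by gcongr
      _ = ε * ‖U n ω‖ := by ring
  -- Eventually `T = U + ‖U‖ • V` with `V → 0`, so the continuous mapping theorem applies to the
  -- pair `(U, V)`. Where `U = 0`, the convention `0⁻¹ = 0` gives `V = 0`, and the relative bound
  -- forces `T = 0`.
  let V : ℕ → Ω → E := fun n ω => ‖U n ω‖⁻¹ • (T n ω - U n ω)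
  have hV n : AEMeasurable (V n) Pr := by
    have h1 := hT n
    have h2 := hU' n
    fun_prop
  have hV0 : TendstoInMeasure Pr V atTop fun _ => (0 : E) := by
    refine tendstoInMeasure_of_tendsto_ae (fun n => (hV n).aestronglyMeasurable) ?_
    filter_upwards [ae_all_iff.2 fun k : ℕ => hrel (1 / ((k : ℝ) + 1)) Nat.one_div_pos_of_nat]
      with ω hω
    refine Metric.tendsto_nhds.2 fun η hη => ?_
    obtain ⟨k, hk⟩ := exists_nat_one_div_lt hη
    filter_upwards [hω k] with n hn
    rw [dist_zero_right, norm_smul, norm_inv, norm_norm]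
    refine lt_of_le_of_lt ?_ hk
    rcases eq_or_ne (‖U n ω‖) 0 with h0 | h0
    · rw [h0, inv_zero, zero_mul]; positivity
    · have : 0 < ‖U n ω‖ := lt_of_le_of_ne (norm_nonneg _) h0.symm
      rw [inv_mul_le_iff₀ this, mul_comm]
      exact hn
  have hX := TendstoInDistribution.continuous_comp_prodMk_of_tendstoInMeasure_const
    (g := fun p : E × E => p.1 + ‖p.1‖ • p.2) (by fun_prop) hU hV0 hV
  simp only [smul_zero, add_zero] at hX
  refine tendstoInDistribution_of_tendstoInMeasure_sub T Z hX ?_ hT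
  refine tendstoInMeasure_of_tendsto_ae
    (fun n => ((hT n).sub (hX.forall_aemeasurable n)).aestronglyMeasurable) ?_
  filter_upwards [hrel 1 one_pos] with ω hω
  refine tendsto_const_nhds.congr' ?_
  filter_upwards [hω] with n hn
  rcases eq_or_ne (‖U n ω‖) 0 with h0 | h0
  · rw [h0, mul_zero, norm_le_zero_iff] at hn
    simp [h0, V, hn]
  · simp [V, smul_smul, mul_inv_cancel₀ h0]

/-! ### Calculus of partial derivatives. -/

section PartialDerivatives

variable {d : ℕ}

local notation "𝔼" => EuclideanSpace ℝ (Fin d)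

theorem fderiv_eq_sum_pderiv (g : 𝔼 → ℝ) (β v : 𝔼) :
    fderiv ℝ g β v = ∑ i, v i * pderiv i g β := by
  have hv : v = ∑ i, v i • EuclideanSpace.single i (1 : ℝ) := by
    simpa using ((EuclideanSpace.basisFun (Fin d) ℝ).sum_repr v).symm
  conv_lhs => rw [hv]
  simp [pderiv]

theorem pderiv_congr {f g : 𝔼 → ℝ} {β : 𝔼} (h : f =ᶠ[𝓝 β] g) (j : Fin d) :
    pderiv j f β = pderiv j g β := by
  simp only [pderiv, h.fderiv_eq]

theorem contDiffOn_pderiv {g : 𝔼 → ℝ} {U : Set 𝔼} (hU : IsOpen U) (hg : ContDiffOn ℝ 2 g U)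
    (j : Fin d) : ContDiffOn ℝ 1 (pderiv j g) U :=
  (hg.fderiv_of_isOpen hU (by norm_num)).clm_apply contDiffOn_const

theorem continuousOn_pderiv {g : 𝔼 → ℝ} {U : Set 𝔼} (hU : IsOpen U) (hg : ContDiffOn ℝ 1 g U)
    (j : Fin d) : ContinuousOn (pderiv j g) U :=
  (hg.continuousOn_fderiv_of_isOpen hU le_rfl).clm_apply continuousOn_const

/-- Makes the expected Hessian symmetric, which the sandwich form of the covariance relies on. -/
theorem pderiv_comm {g : 𝔼 → ℝ} {β : 𝔼} (hg : ContDiffAt ℝ 2 g β) (i j : Fin d) :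
    pderiv i (pderiv j g) β = pderiv j (pderiv i g) β := by
  have hd : DifferentiableAt ℝ (fderiv ℝ g) β :=
    (hg.fderiv_right (m := 1) (by norm_num)).differentiableAt (by norm_num)
  have key (i j : Fin d) : pderiv i (pderiv j g) β =
      fderiv ℝ (fderiv ℝ g) β (EuclideanSpace.single i 1) (EuclideanSpace.single j 1) := by
    have : pderiv j g = fun b => fderiv ℝ g b (EuclideanSpace.single j 1) := rfl
    rw [this, pderiv, fderiv_clm_apply hd (differentiableAt_const _)]
    simp
  rw [key, key]
  exact hg.isSymmSndFDerivAt (by simp) _ _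

theorem pderiv_average {ι : Type*} (s : Finset ι) (c : ℝ) {φ : ι → 𝔼 → ℝ} {β : 𝔼}
    (hφ : ∀ i ∈ s, DifferentiableAt ℝ (φ i) β) (j : Fin d) :
    pderiv j (fun b => c * ∑ i ∈ s, φ i b) β = c * ∑ i ∈ s, pderiv j (φ i) β := by
  have h1 : DifferentiableAt ℝ (fun b => ∑ i ∈ s, φ i b) β := DifferentiableAt.fun_sum hφ
  simp [pderiv, fderiv_const_mul h1, fderiv_fun_sum hφ]

/-- The partial derivative is a pointwise limit of measurable difference quotients along steps `1 /
(n + N)`, where `N` is large enough to keep the shifted parameter in `U`. -/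
theorem measurable_pderiv {W : Type*} [MeasurableSpace W] {g : 𝔼 → W → ℝ} {U : Set 𝔼}
    {β : 𝔼} (hU : U ∈ 𝓝 β) (hmeas : ∀ b ∈ U, Measurable (g b))
    (hdiff : ∀ w, DifferentiableAt ℝ (fun b => g b w) β) (j : Fin d) :
    Measurable fun w => pderiv j (fun b => g b w) β := by
  set v : 𝔼 := EuclideanSpace.single j 1
  have hlim : Tendsto (fun n : ℕ => β + (n : ℝ)⁻¹ • v) atTop (𝓝 β) := by
    simpa using (tendsto_const_nhds (x := β)).add
      ((tendsto_inv_atTop_nhds_zero_nat (𝕜 := ℝ)).smul_const v)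
  obtain ⟨N, hN⟩ := eventually_atTop.1 (hlim.eventually hU)
  refine measurable_of_tendsto_metrizable
    (f := fun (n : ℕ) w => ((n + N : ℕ) : ℝ) • (g (β + ((n + N : ℕ) : ℝ)⁻¹ • v) w - g β w))
    (fun n => ?_) ?_
  · have h1 := hmeas _ (hN (n + N) (Nat.le_add_left _ _))
    have h2 := hmeas β (mem_of_mem_nhds hU)
    fun_prop
  · refine tendsto_pi_nhds.2 fun w => ?_
    have := (hdiff w).hasFDerivAt.lim_real v
    exact (this.comp tendsto_natCast_atTop_atTop).comp (tendsto_add_atTop_nat N)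

/-- First order expansion with an explicit remainder bound. -/
theorem abs_sub_sub_sum_le {G : 𝔼 → ℝ} {β₀ β : 𝔼} {δ η : ℝ} {a : Fin d → ℝ}
    (hβ : β ∈ Metric.ball β₀ δ) (hG : ∀ b ∈ Metric.ball β₀ δ, DifferentiableAt ℝ G b)
    (ha : ∀ b ∈ Metric.ball β₀ δ, ∀ i, |pderiv i G b - a i| ≤ η) :
    |G β - G β₀ - ∑ i, a i * (β - β₀) i| ≤ d * η * ‖β - β₀‖ := by
  have hδ : 0 < δ := dist_nonneg.trans_lt hβ
  let φ : 𝔼 →L[ℝ] ℝ := ∑ i, a i • EuclideanSpace.proj i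
  have hφ v : φ v = ∑ i, a i * v i := by simp [φ]
  -- The sign of `η` can be read off the hypothesis only if there is a coordinate; for `d = 0` the
  -- product vanishes.
  have hη : 0 ≤ d * η := by
    rcases Nat.eq_zero_or_pos d with h | h
    · simp [h]
    · exact mul_nonneg (Nat.cast_nonneg _)
        ((abs_nonneg _).trans (ha β hβ ⟨0, h⟩))
  have h := (convex_ball β₀ δ).norm_image_sub_le_of_norm_fderiv_le' (f := G) (φ := φ)
    (C := d * η) (x := β₀) (y := β) hG (fun b hb => ?_) (Metric.mem_ball_self hδ) hβ
  · rwa [hφ, Real.norm_eq_abs] at h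
  · refine ContinuousLinearMap.opNorm_le_bound _ hη fun v => ?_
    rw [sub_apply, hφ, fderiv_eq_sum_pderiv, ← Finset.sum_sub_distrib]
    calc _ ≤ ∑ i : Fin d, |v i * pderiv i G b - a i * v i| := Finset.abs_sum_le_sum_abs _ _
      _ ≤ ∑ _i : Fin d, η * ‖v‖ := by
        refine Finset.sum_le_sum fun i _ => ?_
        rw [show v i * pderiv i G b - a i * v i = (pderiv i G b - a i) * v i by ring, abs_mul]
        exact mul_le_mul (ha b hb i) (PiLp.norm_apply_le v i) (abs_nonneg _)
          ((abs_nonneg _).trans (ha b hb i))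
      _ = d * η * ‖v‖ := by simp; ring

end PartialDerivatives

/-! ### Asymptotic normality of M-estimators. -/

section MEstimator

variable {d : ℕ} {W Ω : Type*} [MeasurableSpace W] [MeasurableSpace Ω] {P : Measure W}
  {Pr : Measure Ω} {ξ : ℕ → Ω → W}

local notation "𝔼" => EuclideanSpace ℝ (Fin d)

theorem norm_le_sum_abs (v : 𝔼) : ‖v‖ ≤ ∑ i, |v i| := by
  have hv : v = ∑ i, v i • EuclideanSpace.single i (1 : ℝ) := by
    simpa using ((EuclideanSpace.basisFun (Fin d) ℝ).sum_repr v).symm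
  conv_lhs => rw [hv]
  refine (norm_sum_le _ _).trans (Finset.sum_le_sum fun i _ => ?_)
  simp [norm_smul]

/-- The score has mean zero at an interior maximizer of the expected criterion. -/
theorem integral_pderiv_eq_zero_of_isMax {m : 𝔼 → W → ℝ} {βs : 𝔼} {r : ℝ} (hr : 0 < r)
    (hmeas : ∀ β ∈ Metric.ball βs r, Measurable (m β))
    (hint : Integrable (m βs) P)
    (hdiff : ∀ w, ∀ β ∈ Metric.ball βs r, DifferentiableAt ℝ (fun b => m b w) β) (j : Fin d)
    {h : W → ℝ} (hh : Integrable h P)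
    (hdom : ∀ β ∈ Metric.ball βs r, ∀ w, |pderiv j (fun b => m b w) β| ≤ h w)
    (hmax : ∀ β ∈ Metric.ball βs r, ∫ w, m β w ∂P ≤ ∫ w, m βs w ∂P) :
    ∫ w, pderiv j (fun b => m b w) βs ∂P = 0 := by
  set v : 𝔼 := EuclideanSpace.single j 1 with hv
  have hmem (t : ℝ) (ht : t ∈ Metric.ball (0 : ℝ) r) : βs + t • v ∈ Metric.ball βs r := by
    rw [mem_ball_zero_iff] at ht
    simpa [hv, norm_smul] using ht
  have hline t : HasDerivAt (fun t : ℝ => βs + t • v) v t := by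
    simpa using ((hasDerivAt_id t).smul_const v).const_add βs
  -- Differentiation under the integral along the coordinate line through `βs`; the expected
  -- criterion has a local maximum at parameter `0`.
  have hd := (hasDerivAt_integral_of_dominated_loc_of_deriv_le (μ := P) (x₀ := (0 : ℝ))
    (F := fun t w => m (βs + t • v) w) (F' := fun t w => pderiv j (fun b => m b w) (βs + t • v))
    (bound := h) (Metric.ball_mem_nhds 0 hr) ?_ (by simpa using hint) ?_
    (ae_of_all _ fun w t ht => hdom _ (hmem t ht) w) hh
    (ae_of_all _ fun w t ht => ?_)).2
  · have hloc : IsLocalMax (fun t : ℝ => ∫ w, m (βs + t • v) w ∂P) 0 := by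
      filter_upwards [Metric.ball_mem_nhds (0 : ℝ) hr] with t ht
      simpa using hmax _ (hmem t ht)
    simpa using hloc.hasDerivAt_eq_zero hd
  · filter_upwards [Metric.ball_mem_nhds (0 : ℝ) hr] with t ht
    exact (hmeas _ (hmem t ht)).aestronglyMeasurable
  · simp only [zero_smul, add_zero]
    exact (measurable_pderiv (Metric.ball_mem_nhds βs hr) hmeas
      (fun w => hdiff w βs (Metric.mem_ball_self hr)) j).aestronglyMeasurable
  · exact (hdiff w _ (hmem t ht)).hasFDerivAt.comp_hasDerivAt t (hline t)

/-- **Asymptotic linearity** of a consistent M-estimator: `√n (βhat - βs)` is, up to a negligible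
fraction of itself, the normalized sum of the influence functions `-A⁻¹ ∂m(βs)`. -/
theorem eventually_norm_sub_influence_le [IsProbabilityMeasure P]
    (hlaw : ∀ i, HasLaw (ξ i) P Pr) (hindep : iIndepFun ξ Pr)
    {K : Set 𝔼} {βs : 𝔼} {r : ℝ} (hr : 0 < r) (hball : Metric.ball βs r ⊆ K)
    {m : 𝔼 → W → ℝ} (hmeas : ∀ β ∈ K, Measurable (m β))
    (hC2 : ∀ w, ContDiffOn ℝ 2 (fun b => m b w) (Metric.ball βs r))
    (hdom : ∀ i j, ∃ h : W → ℝ, Integrable h P ∧ ∀ β ∈ Metric.ball βs r, ∀ w,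
      |pderiv i (pderiv j fun b => m b w) β| ≤ h w)
    {A : Matrix (Fin d) (Fin d) ℝ}
    (hA : ∀ i j, A i j = ∫ w, pderiv i (pderiv j fun b => m b w) βs ∂P) (hdet : A.det ≠ 0)
    {βhat : ℕ → Ω → 𝔼} (hcons : ∀ᵐ ω ∂Pr, Tendsto (fun n => βhat n ω) atTop (𝓝 βs))
    (hβhat : ∀ n : ℕ, ∀ᵐ ω ∂Pr, ∀ β ∈ K,
      1 / (n : ℝ) * ∑ i ∈ Finset.range n, m β (ξ i ω) ≤
        1 / (n : ℝ) * ∑ i ∈ Finset.range n, m (βhat n ω) (ξ i ω)) {ε : ℝ} (hε : 0 < ε) :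
    ∀ᵐ ω ∂Pr, ∀ᶠ n : ℕ in atTop,
      ‖√(n : ℝ) • (βhat n ω - βs) - (√(n : ℝ))⁻¹ • ∑ k ∈ Finset.range n,
        WithLp.toLp 2 (fun i => -∑ j, A⁻¹ i j * pderiv j (fun b => m b (ξ k ω)) βs)‖ ≤
      ε * ‖√(n : ℝ) • (βhat n ω - βs)‖ := by
  have hopen : IsOpen (Metric.ball βs r) := Metric.isOpen_ball
  have hβs : βs ∈ Metric.ball βs r := Metric.mem_ball_self hr
  have hdiff w b (hb : b ∈ Metric.ball βs r) : DifferentiableAt ℝ (fun b => m b w) b :=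
    ((hC2 w).contDiffAt (hopen.mem_nhds hb)).differentiableAt (by norm_num)
  have hC1 w j : ContDiffOn ℝ 1 (pderiv j fun b => m b w) (Metric.ball βs r) :=
    contDiffOn_pderiv hopen (hC2 w) j
  have hdiff2 w j b (hb : b ∈ Metric.ball βs r) :
      DifferentiableAt ℝ (pderiv j fun b => m b w) b :=
    ((hC1 w j).contDiffAt (hopen.mem_nhds hb)).differentiableAt (by norm_num)
  have hmeas1 j b (hb : b ∈ Metric.ball βs r) : Measurable fun w => pderiv j (fun b => m b w) b :=
    measurable_pderiv (hopen.mem_nhds hb) (fun b hb => hmeas b (hball hb))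
      (fun w => hdiff w b hb) j
  have hmeas2 i j b (hb : b ∈ Metric.ball βs r) :
      Measurable fun w => pderiv i (pderiv j fun b => m b w) b :=
    measurable_pderiv (g := fun b w => pderiv j (fun b => m b w) b) (hopen.mem_nhds hb)
      (hmeas1 j) (fun w => hdiff2 w j b hb) i
  have hsymm i j : A i j = A j i := by
    rw [hA, hA]
    exact integral_congr_ae (ae_of_all _ fun w =>
      pderiv_comm ((hC2 w).contDiffAt (hopen.mem_nhds hβs)) i j)
  have hunit : IsUnit A.det := isUnit_iff_ne_zero.2 hdet
  set M : ℝ := ∑ i, ∑ j, |A⁻¹ i j| with hM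
  have hM0 : 0 ≤ M := Finset.sum_nonneg fun i _ => Finset.sum_nonneg fun j _ => abs_nonneg _
  -- `d * η` bounds the expansion error of each score coordinate, and applying `A⁻¹` costs at most
  -- `M`. The `+ 1` in the witness covers `M * d = 0`.
  obtain ⟨η, hη, hηε⟩ : ∃ η > 0, M * (d * η) ≤ ε := by
    refine ⟨ε / (M * d + 1), by positivity, ?_⟩
    rw [show M * (d * (ε / (M * d + 1))) = ε * ((M * d) / (M * d + 1)) by ring]
    refine mul_le_of_le_one_right hε.le ((div_le_one (by positivity)).2 (by linarith))
  -- Phrased for all small `δ`, so that one radius serves the finitely many entries `i`, `j`.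
  have hunif : ∀ᶠ δ in 𝓝[>] (0 : ℝ), ∀ i j, ∀ᵐ ω ∂Pr, ∀ᶠ n : ℕ in atTop,
      ∀ β ∈ Metric.ball βs r, dist β βs < δ →
        |1 / (n : ℝ) * ∑ k ∈ Finset.range n, pderiv i (pderiv j fun b => m b (ξ k ω)) β
          - A i j| < η := by
    refine eventually_all.2 fun i => eventually_all.2 fun j => ?_
    obtain ⟨h, hh, hdom'⟩ := hdom i j
    obtain ⟨δ, hδ, h1⟩ := exists_eventually_forall_average_sub_lt hlaw hindep hβs
      (g := fun b w => pderiv i (pderiv j fun b => m b w) b) (hmeas2 i j)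
      (fun w => continuousOn_pderiv hopen (hC1 w j) i) hh hdom' hη
    filter_upwards [Ioo_mem_nhdsGT hδ] with δ' hδ'
    filter_upwards [h1] with ω hω
    filter_upwards [hω] with n hn β hβ hd
    rw [hA]
    exact hn β hβ (hd.trans hδ'.2)
  obtain ⟨δ, hδ1, hδ0, hδr⟩ := (hunif.and (Ioo_mem_nhdsGT hr)).exists
  have hsub : Metric.ball βs δ ⊆ Metric.ball βs r := Metric.ball_subset_ball hδr.le
  filter_upwards [ae_all_iff.2 fun i => ae_all_iff.2 fun j => hδ1 i j, hcons,
    ae_all_iff.2 hβhat] with ω h1 h2 h3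
  filter_upwards [eventually_all.2 fun i => eventually_all.2 fun j => h1 i j,
    h2.eventually (Metric.ball_mem_nhds βs hδ0), eventually_gt_atTop 0] with n h4 h5 hn
  set v := βhat n ω - βs with hv
  let G : Fin d → 𝔼 → ℝ := fun j b =>
    1 / (n : ℝ) * ∑ k ∈ Finset.range n, pderiv j (fun b => m b (ξ k ω)) b
  -- By consistency the estimator is now inside the ball, so it is a local maximum and the score
  -- vanishes.
  have hfoc j : G j (βhat n ω) = 0 := by
    have hloc : IsLocalMax (fun b => 1 / (n : ℝ) * ∑ i ∈ Finset.range n, m b (ξ i ω))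
        (βhat n ω) := by
      filter_upwards [hopen.mem_nhds (hsub h5)] with b hb using h3 n b (hball hb)
    rw [show G j (βhat n ω) = _ from
      (pderiv_average _ _ (fun k _ => hdiff (ξ k ω) _ (hsub h5)) j).symm, pderiv, hloc.fderiv_eq_zero]
    simp
  have hexp j : |G j βs + ∑ i, A j i * v i| ≤ d * η * ‖v‖ := by
    have h6 := abs_sub_sub_sum_le (G := G j) (a := fun i => A j i) (η := η) h5 (fun b hb => ?_)
      (fun b hb i => ?_)
    · rw [hfoc, ← hv] at h6
      rw [← abs_neg]
      convert h6 using 2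
      ring
    · exact (DifferentiableAt.fun_sum fun k _ => hdiff2 _ j b (hsub hb)).const_mul _
    · rw [hsymm, pderiv_average _ _ (fun k _ => hdiff2 (ξ k ω) j b (hsub hb))]
      exact (h4 i j b (hsub hb) hb).le
  have hn' : (0 : ℝ) < n := Nat.cast_pos.2 hn
  have hsq : (√(n : ℝ))⁻¹ = √(n : ℝ) * (1 / (n : ℝ)) := by
    have := Real.mul_self_sqrt hn'.le
    have h0 : √(n : ℝ) ≠ 0 := (Real.sqrt_pos.2 hn').ne'
    field_simp
    rw [sq, this]
  have hinv i : ∑ j, A⁻¹ i j * ∑ k, A j k * v k = v i := by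
    have : (A⁻¹).mulVec (A.mulVec v) = v := by
      rw [Matrix.mulVec_mulVec, Matrix.nonsing_inv_mul _ hunit, Matrix.one_mulVec]
    exact congrFun this i
  -- Writing `v = A⁻¹ (A v)` turns the difference into `√n A⁻¹` applied to the expansion error of
  -- the score.
  have hcomp i : (√(n : ℝ) • v - (√(n : ℝ))⁻¹ • ∑ k ∈ Finset.range n,
        WithLp.toLp 2 (fun i => -∑ j, A⁻¹ i j * pderiv j (fun b => m b (ξ k ω)) βs) : 𝔼) i
      = √(n : ℝ) * ∑ j, A⁻¹ i j * (G j βs + ∑ k, A j k * v k) := by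
    simp only [mul_add, Finset.sum_add_distrib, hinv]
    simp only [PiLp.sub_apply, PiLp.smul_apply, smul_eq_mul, WithLp.ofLp_sum, Finset.sum_apply,
      Finset.sum_neg_distrib, hsq, G]
    rw [Finset.sum_comm]
    rw [mul_neg, sub_neg_eq_add, add_comm, mul_assoc]
    congr 2
    simp only [Finset.mul_sum]
    exact Finset.sum_congr rfl fun _ _ => Finset.sum_congr rfl fun _ _ => by ring
  calc _ ≤ ∑ i, |√(n : ℝ) * ∑ j, A⁻¹ i j * (G j βs + ∑ k, A j k * v k)| := by
        refine (norm_le_sum_abs _).trans (Finset.sum_le_sum fun i _ => ?_)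
        rw [hcomp]
    _ ≤ ∑ i, √(n : ℝ) * ∑ j, |A⁻¹ i j| * (d * η * ‖v‖) := by
        refine Finset.sum_le_sum fun i _ => ?_
        rw [abs_mul, abs_of_nonneg (Real.sqrt_nonneg _)]
        gcongr
        refine (Finset.abs_sum_le_sum_abs _ _).trans (Finset.sum_le_sum fun j _ => ?_)
        rw [abs_mul]
        gcongr
        exact hexp j
    _ = M * (d * η) * ‖√(n : ℝ) • v‖ := by
        rw [norm_smul, Real.norm_of_nonneg (Real.sqrt_nonneg _), hM]
        simp only [← Finset.mul_sum, ← Finset.sum_mul]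
        ring
    _ ≤ ε * ‖√(n : ℝ) • v‖ := by gcongr

/-- **Asymptotic normality of M-estimators** with an interior maximizer, together with the positive
semidefiniteness of the sandwich covariance matrix. -/
theorem asymptoticNormality_argmax [IsProbabilityMeasure P] [IsProbabilityMeasure Pr]
    (hlaw : ∀ i, HasLaw (ξ i) P Pr) (hindep : iIndepFun ξ Pr)
    {K : Set 𝔼} (hK : IsCompact K) {βs : 𝔼} {r : ℝ} (hr : 0 < r) (hball : Metric.ball βs r ⊆ K)
    {m : 𝔼 → W → ℝ} (hmeas : ∀ β ∈ K, Measurable (m β))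
    (hcont : ∀ w, ContinuousOn (fun β => m β w) K) {h : W → ℝ} (hint : Integrable h P)
    (hdom : ∀ β ∈ K, ∀ w, |m β w| ≤ h w)
    (hmax : ∀ β ∈ K, β ≠ βs → ∫ w, m β w ∂P < ∫ w, m βs w ∂P)
    (hC2 : ∀ w, ContDiffOn ℝ 2 (fun b => m b w) (Metric.ball βs r))
    (hdom1 : ∀ j, ∃ h : W → ℝ, Integrable h P ∧ ∀ β ∈ Metric.ball βs r, ∀ w,
      |pderiv j (fun b => m b w) β| ≤ h w)
    (hdom2 : ∀ i j, ∃ h : W → ℝ, Integrable h P ∧ ∀ β ∈ Metric.ball βs r, ∀ w,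
      |pderiv i (pderiv j fun b => m b w) β| ≤ h w)
    {A B : Matrix (Fin d) (Fin d) ℝ}
    (hA : ∀ i j, A i j = ∫ w, pderiv i (pderiv j fun b => m b w) βs ∂P) (hdet : A.det ≠ 0)
    (hB_int : ∀ i j, Integrable
      (fun w => pderiv i (fun b => m b w) βs * pderiv j (fun b => m b w) βs) P)
    (hB : ∀ i j, B i j = ∫ w, pderiv i (fun b => m b w) βs * pderiv j (fun b => m b w) βs ∂P)
    {βhat : ℕ → Ω → 𝔼} (hβhat_meas : ∀ n, AEMeasurable (βhat n) Pr)
    (hβhat : ∀ n : ℕ, ∀ᵐ ω ∂Pr, βhat n ω ∈ K ∧ ∀ β ∈ K,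
      1 / (n : ℝ) * ∑ i ∈ Finset.range n, m β (ξ i ω) ≤
        1 / (n : ℝ) * ∑ i ∈ Finset.range n, m (βhat n ω) (ξ i ω)) :
    (A⁻¹ * B * A⁻¹).PosSemidef ∧
      TendstoInDistribution (fun (n : ℕ) ω => √(n : ℝ) • (βhat n ω - βs)) atTop id (fun _ => Pr)
        (multivariateGaussian 0 (A⁻¹ * B * A⁻¹)) := by
  have hopen : IsOpen (Metric.ball βs r) := Metric.isOpen_ball
  have hβs : βs ∈ Metric.ball βs r := Metric.mem_ball_self hr
  have hdiff w b (hb : b ∈ Metric.ball βs r) : DifferentiableAt ℝ (fun b => m b w) b :=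
    ((hC2 w).contDiffAt (hopen.mem_nhds hb)).differentiableAt (by norm_num)
  have hmeas1 j : Measurable fun w => pderiv j (fun b => m b w) βs :=
    measurable_pderiv (hopen.mem_nhds hβs) (fun b hb => hmeas b (hball hb))
      (fun w => hdiff w βs hβs) j
  have hAsymm : A.transpose = A := by
    ext i j
    rw [Matrix.transpose_apply, hA, hA]
    exact integral_congr_ae (ae_of_all _ fun w =>
      pderiv_comm ((hC2 w).contDiffAt (hopen.mem_nhds hβs)) j i)
  -- With this symmetry `A⁻¹ B A⁻¹` equals `A⁻¹ B (A⁻¹)ᵀ`, the second moment matrix of `-A⁻¹ s`.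
  have hAinv i j : A⁻¹ i j = A⁻¹ j i := by
    conv_lhs => rw [← hAsymm, ← Matrix.transpose_nonsing_inv, Matrix.transpose_apply]
  let s : Fin d → W → ℝ := fun j w => pderiv j (fun b => m b w) βs
  have hs_int j : Integrable (s j) P := by
    obtain ⟨h1, h2, h3⟩ := hdom1 j
    exact h2.mono' (hmeas1 j).aestronglyMeasurable (ae_of_all _ fun w => h3 βs hβs w)
  have hs_mean j : ∫ w, s j w ∂P = 0 := by
    obtain ⟨h1, h2, h3⟩ := hdom1 j
    refine integral_pderiv_eq_zero_of_isMax hr (fun b hb => hmeas b (hball hb))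
      (hint.mono' (hmeas _ (hball hβs)).aestronglyMeasurable
        (ae_of_all _ fun w => hdom _ (hball hβs) w)) hdiff j h2 h3 fun b hb => ?_
    rcases eq_or_ne b βs with rfl | hne
    · exact le_rfl
    · exact (hmax b (hball hb) hne).le
  let η : W → 𝔼 := fun w => WithLp.toLp 2 fun i => -∑ j, A⁻¹ i j * s j w
  have hη_meas : Measurable η := by
    refine (WithLp.measurable_toLp 2 _).comp (measurable_pi_lambda _ fun i => ?_)
    exact (Finset.measurable_sum _ fun j _ => (hmeas1 j).const_mul _).neg
  have hprod i j w : η w i * η w j = ∑ k, ∑ l, A⁻¹ i k * A⁻¹ j l * (s k w * s l w) := by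
    simp only [η, neg_mul_neg, Finset.sum_mul_sum]
    exact Finset.sum_congr rfl fun k _ => Finset.sum_congr rfl fun l _ => by ring
  have hη_int i j : Integrable (fun w => η w i * η w j) P := by
    simp only [hprod]
    exact integrable_finsetSum _ fun k _ => integrable_finsetSum _ fun l _ =>
      (hB_int k l).const_mul _
  have hη_cov i j : (A⁻¹ * B * A⁻¹) i j = ∫ w, η w i * η w j ∂P := by
    simp only [hprod]
    rw [integral_finsetSum _ fun k _ => integrable_finsetSum _ fun l _ => (hB_int k l).const_mul _]
    simp only [Matrix.mul_apply, Finset.sum_mul]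
    rw [Finset.sum_comm]
    refine Finset.sum_congr rfl fun k _ => ?_
    rw [integral_finsetSum _ fun l _ => (hB_int k l).const_mul _]
    refine Finset.sum_congr rfl fun l _ => ?_
    rw [integral_const_mul, ← hB, hAinv l j]
    ring
  have hη_mean i : ∫ w, η w i ∂P = 0 := by
    simp only [η]
    rw [integral_neg, integral_finsetSum _ fun j _ => (hs_int j).const_mul _]
    simp [integral_const_mul, hs_mean]
  refine ⟨posSemidef_of_integral_mul hη_int hη_cov, ?_⟩
  have hcomp {φ : W → ℝ} (hφ : Measurable φ) : ∫ ω, φ (ξ 0 ω) ∂Pr = ∫ w, φ w ∂P :=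
    (hlaw 0).integral_comp hφ.aestronglyMeasurable
  have hcoord i : Measurable fun w => η w i := by fun_prop
  have hclt := tendstoInDistribution_inv_sqrt_smul_sum (Pr := Pr) (η := fun k ω => η (ξ k ω))
    (S := A⁻¹ * B * A⁻¹)
    (fun i j => by
      have := hη_int i j
      rw [← (hlaw 0).map_eq] at this
      exact this.comp_aemeasurable (hlaw 0).aemeasurable)
    (fun i j => by rw [hη_cov]; exact (hcomp ((hcoord i).mul (hcoord j))).symm)
    (fun i => by rw [← hη_mean i]; exact hcomp (hcoord i))
    (hindep.comp (fun _ => η) fun _ => hη_meas)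
    fun n => ((hlaw n).identDistrib (hlaw 0)).comp hη_meas
  have hcons := tendsto_argmax hlaw hindep hK (hball hβs) hmeas hcont hint hdom hmax hβhat
  refine tendstoInDistribution_of_norm_sub_le hclt (fun n => ?_) fun ε hε =>
    eventually_norm_sub_influence_le hlaw hindep hr hball hmeas hC2 hdom2 hA hdet hcons
      (fun n => (hβhat n).mono fun ω h => h.2) hε
  exact ((hβhat_meas n).sub_const βs).fun_const_smul _

end MEstimator

/-! ### Derivatives of logarithms and Landau's inequality. -/

section Calculus

variable {d : ℕ}

local notation "𝔼" => EuclideanSpace ℝ (Fin d)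

theorem contDiffOn_two_of_pderiv {g : 𝔼 → ℝ} {U : Set 𝔼} (hU : IsOpen U)
    (hg : DifferentiableOn ℝ g U) (hg' : ∀ j, ContDiffOn ℝ 1 (pderiv j g) U) :
    ContDiffOn ℝ 2 g U := by
  rw [show (2 : WithTop ℕ∞) = 1 + 1 by norm_num, contDiffOn_succ_iff_fderiv_of_isOpen hU]
  refine ⟨hg, by simp, ?_⟩
  have : fderiv ℝ g = fun b => ∑ j, pderiv j g b • (EuclideanSpace.proj j : 𝔼 →L[ℝ] ℝ) := by
    ext b v
    rw [fderiv_eq_sum_pderiv]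
    simp [mul_comm]
  rw [this]
  exact ContDiffOn.sum fun j _ => (hg' j).smul contDiffOn_const

theorem pderiv_log_mul {q : 𝔼 → ℝ} {β : 𝔼} {a : ℝ} (hq : DifferentiableAt ℝ q β) (h0 : q β ≠ 0)
    (ha : a ≠ 0) (j : Fin d) :
    pderiv j (fun b => Real.log (q b * a)) β = pderiv j q β / q β := by
  have h := (hq.hasFDerivAt.mul_const a).log (mul_ne_zero h0 ha)
  simp only [pderiv, h.fderiv, _root_.smul_apply, smul_eq_mul]
  field_simp

theorem pderiv_div {p q : 𝔼 → ℝ} {β : 𝔼} (hp : DifferentiableAt ℝ p β)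
    (hq : DifferentiableAt ℝ q β) (h0 : q β ≠ 0) (i : Fin d) :
    pderiv i (fun b => p b / q b) β = (pderiv i p β * q β - p β * pderiv i q β) / q β ^ 2 := by
  have h := hp.hasFDerivAt.fun_mul ((hasDerivAt_inv h0).comp_hasFDerivAt β hq.hasFDerivAt)
  simp only [pderiv, div_eq_mul_inv]
  rw [show fderiv ℝ (fun b => p b * (q b)⁻¹) β = _ from h.fderiv]
  simp
  field_simp
  ring

/-- **Landau's inequality**: a function with values in `[0, 1]` whose second derivative is bounded
by `H` has its squared first derivative bounded by a multiple of `H` plus a constant. -/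
theorem sq_pderiv_le {g : 𝔼 → ℝ} {β : 𝔼} {r H : ℝ} (hr : 0 < r) (j : Fin d)
    (hg : ∀ b ∈ Metric.ball β r, DifferentiableAt ℝ g b)
    (hg' : ∀ b ∈ Metric.ball β r, DifferentiableAt ℝ (pderiv j g) b)
    (hbd : ∀ b ∈ Metric.ball β r, 0 ≤ g b ∧ g b ≤ 1)
    (hH : ∀ b ∈ Metric.ball β r, |pderiv j (pderiv j g) b| ≤ H) :
    pderiv j g β ^ 2 ≤ 4 * (H + 4 / r ^ 2) := by
  have hH0 : 0 ≤ H := (abs_nonneg _).trans (hH β (Metric.mem_ball_self hr))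
  set Q := H + 4 / r ^ 2 with hQ
  have hQ0 : 0 < Q := by positivity
  -- This step length makes both errors `1 / t` and `t * H` at most `√Q`; the summand `4 / r ^ 2` in
  -- `Q` forces `t ≤ r / 2`, so the segment stays in the ball.
  set t := (√Q)⁻¹ with ht
  have hsq : √Q * √Q = Q := Real.mul_self_sqrt hQ0.le
  have hs0 : 0 < √Q := Real.sqrt_pos.2 hQ0
  have ht0 : 0 < t := inv_pos.2 hs0
  have htr : t < r := by
    have h1 : 2 / r ≤ √Q := by
      refine Real.le_sqrt_of_sq_le ?_
      rw [div_pow, hQ]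
      norm_num
      exact hH0
    rw [ht, inv_lt_comm₀ hs0 hr]
    refine lt_of_lt_of_le ?_ h1
    rw [inv_eq_one_div]
    gcongr
    norm_num
  set v : 𝔼 := EuclideanSpace.single j 1 with hv
  have hmem s (hs : s ∈ Set.Icc 0 t) : β + s • v ∈ Metric.ball β r := by
    have : |s| < r := by rw [abs_of_nonneg hs.1]; exact hs.2.trans_lt htr
    simpa [hv, norm_smul] using this
  have hline s : HasDerivAt (fun s : ℝ => β + s • v) v s := by
    simpa using ((hasDerivAt_id s).smul_const v).const_add β
  have hd {φ : 𝔼 → ℝ} (hφ : ∀ b ∈ Metric.ball β r, DifferentiableAt ℝ φ b) s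
      (hs : s ∈ Set.Icc 0 t) :
      HasDerivAt (fun s : ℝ => φ (β + s • v)) (pderiv j φ (β + s • v)) s :=
    (hφ _ (hmem s hs)).hasFDerivAt.comp_hasDerivAt s (hline s)
  have mvt {φ : 𝔼 → ℝ} (hφ : ∀ b ∈ Metric.ball β r, DifferentiableAt ℝ φ b) s
      (hs : s ∈ Set.Ioc 0 t) : ∃ x ∈ Set.Ioo 0 s,
      φ (β + s • v) - φ β = s * pderiv j φ (β + x • v) := by
    obtain ⟨x, hx, h⟩ := exists_hasDerivAt_eq_slope (fun s : ℝ => φ (β + s • v))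
      (fun s => pderiv j φ (β + s • v)) hs.1
      (fun y hy => (hd hφ y ⟨hy.1, hy.2.trans hs.2⟩).continuousAt.continuousWithinAt)
      fun y hy => hd hφ y ⟨hy.1.le, hy.2.le.trans hs.2⟩
    refine ⟨x, hx, ?_⟩
    have := hs.1.ne'
    rw [h]
    simp
    field_simp
  -- Some point of the segment has derivative at most `1 / t` in absolute value, because `g` varies
  -- by at most `1`; a second mean value step returns to `β` at cost `t * H`.
  obtain ⟨x, hx, h1⟩ := mvt hg t ⟨ht0, le_rfl⟩
  obtain ⟨y, hy, h2⟩ := mvt hg' x ⟨hx.1, hx.2.le⟩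
  have h3 : |t * pderiv j g (β + x • v)| ≤ 1 := by
    rw [← h1, abs_le]
    have h4 := hbd _ (hmem t ⟨ht0.le, le_rfl⟩)
    have h5 := hbd _ (Metric.mem_ball_self hr)
    constructor <;> linarith
  have h4 : |x * pderiv j (pderiv j g) (β + y • v)| ≤ t * H := by
    rw [abs_mul, abs_of_pos hx.1]
    exact mul_le_mul hx.2.le (hH _ (hmem y ⟨hy.1.le, hy.2.le.trans hx.2.le⟩)) (abs_nonneg _) ht0.le
  rw [abs_mul, abs_of_pos ht0, mul_comm, ← le_div_iff₀ ht0] at h3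
  have h5 : |pderiv j g β| ≤ 2 * √Q := by
    have h6 : |pderiv j g β| ≤ 1 / t + t * H := by
      rw [← h2] at h4
      have := abs_sub_abs_le_abs_sub (pderiv j g β) (pderiv j g (β + x • v))
      rw [abs_sub_comm] at this
      linarith
    have h7 : t * H ≤ √Q := by
      rw [ht, inv_mul_le_iff₀ hs0, hsq, hQ]
      have : 0 ≤ 4 / r ^ 2 := by positivity
      linarith
    have h8 : 1 / t = √Q := by rw [ht, one_div, inv_inv]
    linarith
  calc pderiv j g β ^ 2 = |pderiv j g β| ^ 2 := (sq_abs _).symm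
    _ ≤ (2 * √Q) ^ 2 := by gcongr
    _ = 4 * Q := by rw [mul_pow, sq (√Q), hsq]; norm_num

end Calculus

/-! ### Bit probabilities and the observed law. -/

section BitModel

variable {k d : ℕ} {𝒳 : Set (EuclideanSpace ℝ (Fin k))} {𝒴 : Set ℝ} {ε l u : ℝ}

theorem bitFlip_truncate_mem (hε : 0 < ε) (hlu : l < u) (z : Bool) (y : ℝ) :
    1 / (Real.exp ε + 1) ≤ bitFlip ε l u z (truncate l u y) ∧
      bitFlip ε l u z (truncate l u y) ≤ 1 := by
  obtain ⟨h1, h2⟩ := truncate_mem hlu y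
  obtain ⟨h3, h4⟩ := bitFlip_mem hε hlu z h1 h2
  refine ⟨h3, h4.trans ?_⟩
  rw [div_le_one (by positivity)]
  linarith

theorem measurable_bitFlip_truncate (z : Bool) :
    Measurable fun y : 𝒴 => bitFlip ε l u z (truncate l u y) :=
  (measurable_bitFlip ε l u z).comp ((measurable_truncate l u).comp measurable_subtype_coe)

theorem integrable_bitFlip_truncate (hε : 0 < ε) (hlu : l < u) (z : Bool) (Q : Measure 𝒴)
    [IsFiniteMeasure Q] : Integrable (fun y : 𝒴 => bitFlip ε l u z (truncate l u y)) Q := by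
  refine Integrable.of_bound (measurable_bitFlip_truncate z).aestronglyMeasurable 1
    (ae_of_all _ fun y => ?_)
  obtain ⟨h1, h2⟩ := bitFlip_truncate_mem hε hlu z (y : ℝ)
  rw [Real.norm_of_nonneg (le_trans (by positivity) h1)]
  exact h2

theorem bitProb_mem (hε : 0 < ε) (hlu : l < u) (F : Kernel 𝒳 𝒴) [IsMarkovKernel F] (z : Bool)
    (x : 𝒳) : 1 / (Real.exp ε + 1) ≤ bitProb ε l u F z x ∧ bitProb ε l u F z x ≤ 1 := by
  have hi := integrable_bitFlip_truncate hε hlu z (F x)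
  constructor
  · simpa [bitProb] using integral_mono (integrable_const _) hi
      fun y => (bitFlip_truncate_mem hε hlu z (y : ℝ)).1
  · simpa [bitProb] using integral_mono hi (integrable_const _)
      fun y => (bitFlip_truncate_mem hε hlu z (y : ℝ)).2

/-- Transfers regularity from one bit to the other: derivatives change only in sign, and lower
semicontinuity becomes upper. -/
theorem bitProb_false (hε : 0 < ε) (hlu : l < u) (F : Kernel 𝒳 𝒴) [IsMarkovKernel F] (x : 𝒳) :
    bitProb ε l u F false x = 1 - bitProb ε l u F true x := by
  rw [eq_sub_iff_add_eq, bitProb, bitProb, ← integral_add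
    (integrable_bitFlip_truncate hε hlu false (F x)) (integrable_bitFlip_truncate hε hlu true (F x))]
  have (y : 𝒴) : bitFlip ε l u false (truncate l u y) + bitFlip ε l u true (truncate l u y) = 1 := by
    simp only [bitFlip]; ring
  simp [this]

theorem measurable_bitProb (F : Kernel 𝒳 𝒴) [IsMarkovKernel F] :
    Measurable fun w : 𝒳 × Bool => bitProb ε l u F w.2 w.1 := by
  refine measurable_from_prod_countable_left fun z => ?_
  exact ((measurable_bitFlip_truncate z).stronglyMeasurable.integral_kernel (κ := F)).measurable

/-- A bit probability is continuous in the parameter when the model densities are. -/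
theorem continuousOn_bitProb (hε : 0 < ε) (hlu : l < u) {ν : Measure 𝒴}
    {𝓑 : Set (EuclideanSpace ℝ (Fin d))} {Fm : EuclideanSpace ℝ (Fin d) → Kernel 𝒳 𝒴}
    (hFm : ∀ β ∈ 𝓑, IsMarkovKernel (Fm β)) {fm : EuclideanSpace ℝ (Fin d) → 𝒳 → 𝒴 → ℝ≥0}
    (hfm_meas : ∀ β ∈ 𝓑, ∀ x, Measurable (fm β x))
    (hfm : ∀ β ∈ 𝓑, ∀ x, Fm β x = ν.withDensity fun y => (fm β x y : ℝ≥0∞))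
    (hfm_cont : ∀ x y, ContinuousOn (fun β => fm β x y) 𝓑) (z : Bool) (x : 𝒳) :
    ContinuousOn (fun β => bitProb ε l u (Fm β) z x) 𝓑 := by
  have hpos z (y : 𝒴) : 0 ≤ bitFlip ε l u z (truncate l u y) :=
    le_trans (by positivity) (bitFlip_truncate_mem hε hlu z (y : ℝ)).1
  have hlint z β (hβ : β ∈ 𝓑) : ENNReal.ofReal (bitProb ε l u (Fm β) z x) =
      ∫⁻ y, fm β x y * ENNReal.ofReal (bitFlip ε l u z (truncate l u y)) ∂ν := by
    have := hFm β hβ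
    rw [bitProb, ofReal_integral_eq_lintegral_ofReal (integrable_bitFlip_truncate hε hlu z _)
      (ae_of_all _ (hpos z)), hfm β hβ x, lintegral_withDensity_eq_lintegral_mul _
      (hfm_meas β hβ x).coe_nnreal_ennreal (measurable_bitFlip_truncate z).ennreal_ofReal]
    rfl
  rw [continuousOn_iff_continuous_domRestrict, continuous_iff_seqContinuous]
  intro b β hb
  -- Fatou's lemma needs no dominating function for the densities, but yields only lower
  -- semicontinuity.
  have hlower (z : Bool) (a : ℝ) (ha : a < bitProb ε l u (Fm β) z x) :
      ∀ᶠ n in atTop, a < bitProb ε l u (Fm (b n)) z x := by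
    have hβpos : 0 < bitProb ε l u (Fm β) z x := by
      have := hFm β β.2
      exact lt_of_lt_of_le (by positivity) (bitProb_mem hε hlu (Fm β) z x).1
    have hfatou : ENNReal.ofReal (bitProb ε l u (Fm β) z x) ≤
        liminf (fun n => ENNReal.ofReal (bitProb ε l u (Fm (b n)) z x)) atTop := by
      simp only [fun n => hlint z (b n) (b n).2, hlint z β β.2]
      have hpt (y : 𝒴) : Tendsto
          (fun n => (fm (b n) x y : ℝ≥0∞) * ENNReal.ofReal (bitFlip ε l u z (truncate l u y))) atTop
          (𝓝 (fm β x y * ENNReal.ofReal (bitFlip ε l u z (truncate l u y)))) := by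
        refine ENNReal.Tendsto.mul_const ?_ (Or.inr ENNReal.ofReal_ne_top)
        refine ENNReal.tendsto_coe.2 ?_
        exact ((continuousOn_iff_continuous_domRestrict.1 (hfm_cont x y)).tendsto β).comp hb
      calc _ = ∫⁻ y, liminf (fun n => (fm (b n) x y : ℝ≥0∞) *
            ENNReal.ofReal (bitFlip ε l u z (truncate l u y))) atTop ∂ν :=
            lintegral_congr fun y => (hpt y).liminf_eq.symm
        _ ≤ _ := lintegral_liminf_le fun n =>
            (hfm_meas _ (b n).2 x).coe_nnreal_ennreal.mul
              (measurable_bitFlip_truncate z).ennreal_ofReal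
    have h1 : ENNReal.ofReal a < ENNReal.ofReal (bitProb ε l u (Fm β) z x) :=
      (ENNReal.ofReal_lt_ofReal_iff hβpos).2 ha
    filter_upwards [eventually_lt_of_lt_liminf (h1.trans_le hfatou)] with n hn
    exact (ENNReal.ofReal_lt_ofReal_iff'.1 hn).1
  have hneg β (hβ : β ∈ 𝓑) z :
      bitProb ε l u (Fm β) z x = 1 - bitProb ε l u (Fm β) (!z) x := by
    have := hFm β hβ
    cases z <;> simp [bitProb_false hε hlu (Fm β) x]
  refine tendsto_order.2 ⟨fun a ha => hlower z a ha, fun a ha => ?_⟩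
  simp only [Function.comp_apply, Set.domRestrict_apply] at ha ⊢
  rw [hneg β β.2 z] at ha
  -- The upper half is the lower half for the opposite bit, as in Scheffé's lemma.
  filter_upwards [hlower (!z) (1 - a) (by linarith)] with n hn
  rw [hneg _ (b n).2 z]
  linarith

theorem isProbabilityMeasure_userLaw (hε : 0 < ε) (hlu : l < u) (FX : Measure 𝒳)
    [IsProbabilityMeasure FX] (F : Kernel 𝒳 𝒴) [IsMarkovKernel F] :
    IsProbabilityMeasure (userLaw ε l u FX F) := by
  have := isMarkovKernel_reportKernel hε hlu 𝒴
  unfold userLaw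
  infer_instance

theorem isProbabilityMeasure_obsLaw (hε : 0 < ε) (hlu : l < u) (FX : Measure 𝒳)
    [IsProbabilityMeasure FX] (F : Kernel 𝒳 𝒴) [IsMarkovKernel F] :
    IsProbabilityMeasure (obsLaw ε l u FX F) := by
  have := isProbabilityMeasure_userLaw hε hlu FX F
  exact Measure.isProbabilityMeasure_map (by fun_prop)

/-- Carries the integrability of `log f_X` from `F_X` to `P`. -/
theorem map_fst_obsLaw (hε : 0 < ε) (hlu : l < u) (FX : Measure 𝒳)
    [IsProbabilityMeasure FX] (F : Kernel 𝒳 𝒴) [IsMarkovKernel F] :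
    (obsLaw ε l u FX F).map Prod.fst = FX := by
  have := isMarkovKernel_reportKernel hε hlu 𝒴
  rw [obsLaw, Measure.map_map (by fun_prop) (by fun_prop)]
  exact Measure.fst_compProd FX (F ⊗ₖ Kernel.prodMkLeft 𝒳 (reportKernel ε l u 𝒴))

end BitModel

/-! ### Regularity and domination of the log-density. -/

section LogDensity

variable {k d : ℕ} {𝒳 : Set (EuclideanSpace ℝ (Fin k))} {𝒴 : Set ℝ} {ε l u : ℝ} {fX : 𝒳 → ℝ≥0}
  {Fm : EuclideanSpace ℝ (Fin d) → Kernel 𝒳 𝒴} {U : Set (EuclideanSpace ℝ (Fin d))}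

theorem measurable_logDensity (hfX : Measurable fX) {β : EuclideanSpace ℝ (Fin d)}
    [IsMarkovKernel (Fm β)] : Measurable (logDensity ε l u fX Fm β) :=
  ((measurable_bitProb (Fm β)).mul (by fun_prop)).log

/-- The envelope for the uniform law of large numbers: it does not depend on `β`, thanks to the
lower bound on the bit probability. Where `f_X` vanishes, `Real.log 0 = 0` makes the left side zero.
-/
theorem abs_logDensity_le (hε : 0 < ε) (hlu : l < u) {β : EuclideanSpace ℝ (Fin d)}
    [IsMarkovKernel (Fm β)] (w : 𝒳 × Bool) :
    |logDensity ε l u fX Fm β w| ≤ Real.log (Real.exp ε + 1) + |Real.log (fX w.1)| := by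
  have hlog : 0 ≤ Real.log (Real.exp ε + 1) := Real.log_nonneg (by linarith [Real.exp_pos ε])
  rcases eq_or_ne (fX w.1 : ℝ) 0 with h0 | h0
  · simp [logDensity, h0, hlog]
  · obtain ⟨h1, h2⟩ := bitProb_mem hε hlu (Fm β) w.2 w.1
    have hp : 0 < bitProb ε l u (Fm β) w.2 w.1 := lt_of_lt_of_le (by positivity) h1
    rw [logDensity, Real.log_mul hp.ne' h0]
    refine (abs_add_le _ _).trans (add_le_add_left ?_ _)
    rw [abs_of_nonpos (Real.log_nonpos hp.le h2), neg_le, ← Real.log_inv, ← one_div]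
    exact Real.log_le_log (by positivity) h1

/-- At points with `f_X = 0` the convention `Real.log 0 = 0` makes the function constant in `β`, so
regularity holds at every `w`, not just almost everywhere. -/
theorem continuousOn_logDensity {𝓑 : Set (EuclideanSpace ℝ (Fin d))} {w : 𝒳 × Bool}
    (hpos : ∀ β ∈ 𝓑, 0 < bitProb ε l u (Fm β) w.2 w.1)
    (hcont : ContinuousOn (fun β => bitProb ε l u (Fm β) w.2 w.1) 𝓑) :
    ContinuousOn (fun β => logDensity ε l u fX Fm β w) 𝓑 := by
  unfold logDensity
  rcases eq_or_ne (fX w.1 : ℝ) 0 with h0 | h0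
  · simpa [h0] using continuousOn_const
  · exact (hcont.mul continuousOn_const).log fun β hβ => mul_ne_zero (hpos β hβ).ne' h0

theorem contDiffOn_logDensity {w : 𝒳 × Bool}
    (hpos : ∀ β ∈ U, 0 < bitProb ε l u (Fm β) w.2 w.1)
    (hC2 : ContDiffOn ℝ 2 (fun β => bitProb ε l u (Fm β) w.2 w.1) U) :
    ContDiffOn ℝ 2 (fun β => logDensity ε l u fX Fm β w) U := by
  unfold logDensity
  rcases eq_or_ne (fX w.1 : ℝ) 0 with h0 | h0
  · simpa [h0] using contDiffOn_const
  · exact (hC2.mul contDiffOn_const).log fun β hβ => mul_ne_zero (hpos β hβ).ne' h0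

/-- The first two derivatives of `log p_β` are controlled by those of the bit probability. -/
theorem abs_pderiv_logDensity_le {w : 𝒳 × Bool} (hU : IsOpen U) {c : ℝ} (hc : 0 < c)
    (hpos : ∀ β ∈ U, c ≤ bitProb ε l u (Fm β) w.2 w.1)
    (hC2 : ContDiffOn ℝ 2 (fun β => bitProb ε l u (Fm β) w.2 w.1) U)
    {β : EuclideanSpace ℝ (Fin d)} (hβ : β ∈ U) (i j : Fin d) :
    |pderiv j (fun b => logDensity ε l u fX Fm b w) β| ≤
        |pderiv j (fun b => bitProb ε l u (Fm b) w.2 w.1) β| / c ∧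
      |pderiv i (pderiv j fun b => logDensity ε l u fX Fm b w) β| ≤
        |pderiv i (pderiv j fun b => bitProb ε l u (Fm b) w.2 w.1) β| / c +
          |pderiv i (fun b => bitProb ε l u (Fm b) w.2 w.1) β| *
            |pderiv j (fun b => bitProb ε l u (Fm b) w.2 w.1) β| / c ^ 2 := by
  set q : EuclideanSpace ℝ (Fin d) → ℝ := fun b => bitProb ε l u (Fm b) w.2 w.1 with hq
  rcases eq_or_ne (fX w.1 : ℝ) 0 with h0 | h0
  · have h1 : (fun b => logDensity ε l u fX Fm b w) = fun _ => 0 := by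
      ext b
      simp [logDensity, h0]
    have h2 : (pderiv j fun _ : EuclideanSpace ℝ (Fin d) => (0 : ℝ)) = fun _ => 0 := by
      ext b
      simp [pderiv]
    have h3 : pderiv i (fun _ : EuclideanSpace ℝ (Fin d) => (0 : ℝ)) β = 0 := by simp [pderiv]
    rw [h1, h2, h3, abs_zero]
    constructor <;> positivity
  · have hq0 b (hb : b ∈ U) : 0 < q b := hc.trans_le (hpos b hb)
    have hqd b (hb : b ∈ U) : DifferentiableAt ℝ q b :=
      (hC2.contDiffAt (hU.mem_nhds hb)).differentiableAt (by norm_num)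
    have hqd2 : DifferentiableAt ℝ (pderiv j q) β :=
      ((contDiffOn_pderiv hU hC2 j).contDiffAt (hU.mem_nhds hβ)).differentiableAt (by norm_num)
    have hfirst b (hb : b ∈ U) :
        pderiv j (fun b => logDensity ε l u fX Fm b w) b = pderiv j q b / q b :=
      pderiv_log_mul (hqd b hb) (hq0 b hb).ne' h0 j
    have hsecond : pderiv i (pderiv j fun b => logDensity ε l u fX Fm b w) β =
        pderiv i (pderiv j q) β / q β - pderiv i q β * pderiv j q β / q β ^ 2 := by
      rw [pderiv_congr (g := fun b => pderiv j q b / q b)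
        (by filter_upwards [hU.mem_nhds hβ] with b hb using hfirst b hb) i,
        pderiv_div hqd2 (hqd β hβ) (hq0 β hβ).ne']
      have := (hq0 β hβ).ne'
      field_simp
    have hcq := hpos β hβ
    rw [hfirst β hβ, hsecond]
    constructor
    · rw [abs_div, abs_of_pos (hq0 β hβ)]
      gcongr
    · refine (abs_sub _ _).trans ?_
      rw [abs_div, abs_div, abs_mul, abs_of_pos (hq0 β hβ), abs_of_pos (pow_pos (hq0 β hβ) 2)]
      gcongr

/-- On an open set of parameters, either bit probability has the regularity of `Λ_ε`, and its
derivatives agree with those of `Λ_ε` up to sign. -/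
theorem bitProb_regularity (hε : 0 < ε) (hlu : l < u) (hU : IsOpen U)
    (hFm : ∀ β ∈ U, IsMarkovKernel (Fm β)) {x : 𝒳}
    (hC2 : ContDiffOn ℝ 2 (fun β => Lam ε l u Fm β x) U) (z : Bool) :
    ContDiffOn ℝ 2 (fun β => bitProb ε l u (Fm β) z x) U ∧
      (∀ β ∈ U, ∀ j, |pderiv j (fun b => bitProb ε l u (Fm b) z x) β| =
        |pderiv j (fun b => Lam ε l u Fm b x) β|) ∧
      ∀ β ∈ U, ∀ i j, |pderiv i (pderiv j fun b => bitProb ε l u (Fm b) z x) β| =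
        |pderiv i (pderiv j fun b => Lam ε l u Fm b x) β| := by
  cases z
  · have heq : ∀ b ∈ U, bitProb ε l u (Fm b) false x = 1 - Lam ε l u Fm b x := fun b hb => by
      have := hFm b hb
      exact bitProb_false hε hlu (Fm b) x
    have h1 b (hb : b ∈ U) j : pderiv j (fun b => bitProb ε l u (Fm b) false x) b =
        -pderiv j (fun b => Lam ε l u Fm b x) b := by
      rw [pderiv_congr (g := fun b => 1 - Lam ε l u Fm b x)
        (by filter_upwards [hU.mem_nhds hb] with b hb using heq b hb), pderiv, fderiv_const_sub]
      rfl
    refine ⟨(contDiffOn_const.sub hC2).congr heq, fun b hb j => ?_, fun b hb i j => ?_⟩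
    · rw [h1 b hb, abs_neg]
    · rw [pderiv_congr (g := fun b => -pderiv j (fun b => Lam ε l u Fm b x) b)
        (by filter_upwards [hU.mem_nhds hb] with b hb using h1 b hb j), pderiv, fderiv_fun_neg]
      exact abs_neg _
  · exact ⟨hC2, fun _ _ _ => rfl, fun _ _ _ _ => rfl⟩

end LogDensity

end BitLDP

/-! ### The bit-flip model as an instance of the M-estimator theorem. -/

theorem mainTheorem1
    {k d : ℕ} {𝒳 : Set (EuclideanSpace ℝ (Fin k))} {𝒴 : Set ℝ}
    (h𝒳 : MeasurableSet 𝒳) (h𝒴 : MeasurableSet 𝒴)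
    -- privacy level and truncation interval
    (ε l u : ℝ) (hε : 0 < ε) (hlu : l < u)
    -- true distributions of `X` and of `Y` given `X`, with their densities
    (FX : Measure 𝒳) [IsProbabilityMeasure FX] (F : Kernel 𝒳 𝒴) [IsMarkovKernel F]
    (μ : Measure 𝒳) (ν : Measure 𝒴)
    (f : 𝒳 → 𝒴 → ℝ≥0) (hf_meas : ∀ x, Measurable (f x))
    (hf : ∀ x, F x = ν.withDensity fun y => (f x y : ℝ≥0∞))
    (fX : 𝒳 → ℝ≥0) (hfX_meas : Measurable fX)
    (hfX : FX = μ.withDensity fun x => (fX x : ℝ≥0∞))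
    (hfX_log : Integrable (fun x => Real.log (fX x)) FX)
    -- the compact parameter set and the model family with its densities
    (𝓑 : Set (EuclideanSpace ℝ (Fin d))) (h𝓑 : IsCompact 𝓑)
    (Fm : EuclideanSpace ℝ (Fin d) → Kernel 𝒳 𝒴) (hFm : ∀ β ∈ 𝓑, IsMarkovKernel (Fm β))
    (fm : EuclideanSpace ℝ (Fin d) → 𝒳 → 𝒴 → ℝ≥0)
    (hfm_meas : ∀ β ∈ 𝓑, ∀ x, Measurable (fm β x))
    (hfm : ∀ β ∈ 𝓑, ∀ x, Fm β x = ν.withDensity fun y => (fm β x y : ℝ≥0∞))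
    (hfm_cont : ∀ x y, ContinuousOn (fun β => fm β x y) 𝓑)
    -- `β ↦ P log p_β` has the unique maximum `βs`, an interior point
    (βs : EuclideanSpace ℝ (Fin d)) (hβs_int : βs ∈ interior 𝓑)
    (hβs_max : ∀ β ∈ 𝓑, β ≠ βs →
      ∫ w, BitLDP.logDensity ε l u fX Fm β w ∂(BitLDP.obsLaw ε l u FX F) <
        ∫ w, BitLDP.logDensity ε l u fX Fm βs w ∂(BitLDP.obsLaw ε l u FX F))
    -- `Λ'` exists, is measurable in `x` and continuously differentiable in `β`
    (hΛ_diff : ∀ x, DifferentiableOn ℝ (fun β => BitLDP.Lam ε l u Fm β x) (interior 𝓑))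
    (hΛ'_meas : ∀ j, ∀ β ∈ interior 𝓑,
      Measurable fun x => BitLDP.pderiv j (fun b => BitLDP.Lam ε l u Fm b x) β)
    (hΛ'_C1 : ∀ j x, ContDiffOn ℝ 1
      (BitLDP.pderiv j fun b => BitLDP.Lam ε l u Fm b x) (interior 𝓑))
    -- `Λ'` and `Λ''` are dominated by `P`-integrable functions
    (hΛ'_dom : ∀ j, ∃ h : 𝒳 × Bool → ℝ, Integrable h (BitLDP.obsLaw ε l u FX F) ∧
      ∀ β ∈ interior 𝓑, ∀ w,
        |BitLDP.pderiv j (fun b => BitLDP.Lam ε l u Fm b w.1) β| ≤ h w)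
    (hΛ''_dom : ∀ i j, ∃ h : 𝒳 × Bool → ℝ, Integrable h (BitLDP.obsLaw ε l u FX F) ∧
      ∀ β ∈ interior 𝓑, ∀ w,
        |BitLDP.pderiv i (BitLDP.pderiv j fun b => BitLDP.Lam ε l u Fm b w.1) β| ≤ h w)
    -- nonsingularity
    (h_spread : (Matrix.of fun i j : Fin d => ∫ x,
      BitLDP.pderiv i (fun b => BitLDP.Lam ε l u Fm b x) βs *
        BitLDP.pderiv j (fun b => BitLDP.Lam ε l u Fm b x) βs ∂FX).det ≠ 0)
    (hA : (BitLDP.matA ε l u FX F fX Fm βs).det ≠ 0)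
    -- independent users following the protocol
    {Ω : Type*} [MeasurableSpace Ω] (Pr : Measure Ω) [IsProbabilityMeasure Pr]
    (X : ℕ → Ω → 𝒳) (Y : ℕ → Ω → 𝒴) (Z : ℕ → Ω → Bool)
    (h_law : ∀ i, HasLaw (fun ω => (X i ω, Y i ω, Z i ω)) (BitLDP.userLaw ε l u FX F) Pr)
    (h_indep : iIndepFun (fun i ω => (X i ω, Y i ω, Z i ω)) Pr)
    -- the estimator maximizes the log-likelihood of the first `n` observations over `𝓑`
    (βhat : ℕ → Ω → EuclideanSpace ℝ (Fin d)) (hβhat_meas : ∀ n, AEMeasurable (βhat n) Pr)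
    (hβhat : ∀ n, ∀ᵐ ω ∂Pr, βhat n ω ∈ 𝓑 ∧
      ∀ β ∈ 𝓑, BitLDP.logLik ε l u fX Fm n (fun i => (X i ω, Z i ω)) β ≤
        BitLDP.logLik ε l u fX Fm n (fun i => (X i ω, Z i ω)) (βhat n ω)) :
    (∀ i j, Integrable (BitLDP.hess ε l u fX Fm βs i j) (BitLDP.obsLaw ε l u FX F)) ∧
    (∀ i j, Integrable (fun w => BitLDP.score ε l u fX Fm βs i w *
      BitLDP.score ε l u fX Fm βs j w) (BitLDP.obsLaw ε l u FX F)) ∧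
    (BitLDP.matC ε l u FX F fX Fm βs).PosSemidef ∧
    TendstoInDistribution (fun (n : ℕ) ω => √(n : ℝ) • (βhat n ω - βs)) atTop id (fun _ => Pr)
      (multivariateGaussian 0 (BitLDP.matC ε l u FX F fX Fm βs)) := by
  set P := BitLDP.obsLaw ε l u FX F with hP
  have hPprob : IsProbabilityMeasure P := BitLDP.isProbabilityMeasure_obsLaw hε hlu FX F
  have hfX_log' : Integrable (fun w : 𝒳 × Bool => Real.log (fX w.1)) P := by
    have := hfX_log
    rw [← BitLDP.map_fst_obsLaw hε hlu FX F] at this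
    exact this.comp_measurable measurable_fst
  have hopen : IsOpen (interior 𝓑) := isOpen_interior
  have hsub : interior 𝓑 ⊆ 𝓑 := interior_subset
  obtain ⟨R, hR, hball⟩ := Metric.isOpen_iff.1 hopen βs hβs_int
  -- Half the radius: Landau's inequality needs a ball of radius `r` around every point of
  -- `Metric.ball βs r`, still inside the interior.
  obtain ⟨r, hr, hrR⟩ : ∃ r > 0, r + r = R := ⟨R / 2, by positivity, by ring⟩
  have hball_r : Metric.ball βs r ⊆ interior 𝓑 :=
    (Metric.ball_subset_ball (by linarith)).trans hball
  have hball' β (hβ : β ∈ Metric.ball βs r) : Metric.ball β r ⊆ interior 𝓑 := fun b hb => by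
    refine hball (Metric.mem_ball.2 ?_)
    have := dist_triangle b β βs
    rw [Metric.mem_ball] at hb hβ
    linarith
  set c : ℝ := 1 / (Real.exp ε + 1) with hc
  have hc0 : 0 < c := by positivity
  have hpos z x : ∀ β ∈ 𝓑, c ≤ BitLDP.bitProb ε l u (Fm β) z x := fun β hβ => by
    have := hFm β hβ
    exact (BitLDP.bitProb_mem hε hlu (Fm β) z x).1
  have hΛ_C2 x : ContDiffOn ℝ 2 (fun β => BitLDP.Lam ε l u Fm β x) (interior 𝓑) :=
    BitLDP.contDiffOn_two_of_pderiv hopen (hΛ_diff x) fun j => hΛ'_C1 j x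
  have hreg x z := BitLDP.bitProb_regularity hε hlu hopen (fun β hβ => hFm β (hsub hβ)) (hΛ_C2 x) z
  have hm_C2 w : ContDiffOn ℝ 2 (fun β => BitLDP.logDensity ε l u fX Fm β w) (interior 𝓑) :=
    BitLDP.contDiffOn_logDensity (fun β hβ => hc0.trans_le (hpos _ _ β (hsub hβ))) (hreg w.1 w.2).1
  have hm_meas β (hβ : β ∈ 𝓑) : Measurable (BitLDP.logDensity ε l u fX Fm β) := by
    have := hFm β hβ
    exact BitLDP.measurable_logDensity hfX_meas
  choose h₁ h₁_int h₁_dom using hΛ'_dom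
  choose h₂ h₂_int h₂_dom using hΛ''_dom
  have hlandau j β (hβ : β ∈ Metric.ball βs r) (w : 𝒳 × Bool) :
      BitLDP.pderiv j (fun b => BitLDP.Lam ε l u Fm b w.1) β ^ 2 ≤ 4 * (h₂ j j w + 4 / r ^ 2) := by
    refine BitLDP.sq_pderiv_le hr j (fun b hb => ?_) (fun b hb => ?_) (fun b hb => ?_)
      fun b hb => h₂_dom j j b (hball' β hβ hb) w
    · exact (hΛ_diff w.1).differentiableAt (hopen.mem_nhds (hball' β hβ hb))
    · exact ((hΛ'_C1 j w.1).contDiffAt (hopen.mem_nhds (hball' β hβ hb))).differentiableAt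
        (by norm_num)
    · have := hFm b (hsub (hball' β hβ hb))
      obtain ⟨h3, h4⟩ := BitLDP.bitProb_mem hε hlu (Fm b) true w.1
      exact ⟨hc0.le.trans h3, h4⟩
  -- The envelope for products of first derivatives: `|a b| ≤ (a ^ 2 + b ^ 2) / 2` halves Landau's
  -- constant `4`.
  let H : Fin d → Fin d → 𝒳 × Bool → ℝ := fun i j w =>
    2 * (h₂ i i w + 4 / r ^ 2) + 2 * (h₂ j j w + 4 / r ^ 2)
  have hH_int i j : Integrable (H i j) P :=
    (((h₂_int i i).add (integrable_const _)).const_mul 2).add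
      (((h₂_int j j).add (integrable_const _)).const_mul 2)
  have hprod i j β (hβ : β ∈ Metric.ball βs r) (w : 𝒳 × Bool) :
      |BitLDP.pderiv i (fun b => BitLDP.Lam ε l u Fm b w.1) β| *
        |BitLDP.pderiv j (fun b => BitLDP.Lam ε l u Fm b w.1) β| ≤ H i j w := by
    have h1 := hlandau i β hβ w
    have h2 := hlandau j β hβ w
    rw [← sq_abs] at h1 h2
    have h3 := two_mul_le_add_sq |BitLDP.pderiv i (fun b => BitLDP.Lam ε l u Fm b w.1) β|
      |BitLDP.pderiv j (fun b => BitLDP.Lam ε l u Fm b w.1) β|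
    simp only [H]
    linarith
  have hbound1 j β (hβ : β ∈ interior 𝓑) (w : 𝒳 × Bool) :
      |BitLDP.pderiv j (fun b => BitLDP.logDensity ε l u fX Fm b w) β| ≤
        |BitLDP.pderiv j (fun b => BitLDP.Lam ε l u Fm b w.1) β| / c := by
    have h := (BitLDP.abs_pderiv_logDensity_le (fX := fX) (w := w) hopen hc0
      (fun b hb => hpos w.2 w.1 b (hsub hb)) (hreg w.1 w.2).1 hβ j j).1
    rwa [(hreg w.1 w.2).2.1 β hβ] at h
  have hbound2 i j β (hβ : β ∈ Metric.ball βs r) (w : 𝒳 × Bool) :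
      |BitLDP.pderiv i (BitLDP.pderiv j fun b => BitLDP.logDensity ε l u fX Fm b w) β| ≤
        h₂ i j w / c + H i j w / c ^ 2 := by
    have hβ' := hball_r hβ
    have h := (BitLDP.abs_pderiv_logDensity_le (fX := fX) (w := w) hopen hc0
      (fun b hb => hpos w.2 w.1 b (hsub hb)) (hreg w.1 w.2).1 hβ' i j).2
    rw [(hreg w.1 w.2).2.1 β hβ', (hreg w.1 w.2).2.1 β hβ', (hreg w.1 w.2).2.2 β hβ'] at h
    refine h.trans ?_
    gcongr
    · exact h₂_dom i j β hβ' w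
    · exact hprod i j β hβ w
  have hdiff w β (hβ : β ∈ interior 𝓑) :
      DifferentiableAt ℝ (fun b => BitLDP.logDensity ε l u fX Fm b w) β :=
    ((hm_C2 w).contDiffAt (hopen.mem_nhds hβ)).differentiableAt (by norm_num)
  have hmeas1 j β (hβ : β ∈ interior 𝓑) :
      Measurable fun w => BitLDP.pderiv j (fun b => BitLDP.logDensity ε l u fX Fm b w) β :=
    BitLDP.measurable_pderiv (hopen.mem_nhds hβ) (fun b hb => hm_meas b (hsub hb))
      (fun w => hdiff w β hβ) j
  have hmeas2 i j : Measurable (BitLDP.hess ε l u fX Fm βs i j) :=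
    BitLDP.measurable_pderiv
      (g := fun β w => BitLDP.pderiv j (fun b => BitLDP.logDensity ε l u fX Fm b w) β)
      (hopen.mem_nhds hβs_int) (hmeas1 j)
      (fun w => ((BitLDP.contDiffOn_pderiv hopen (hm_C2 w) j).contDiffAt
        (hopen.mem_nhds hβs_int)).differentiableAt (by norm_num)) i
  have hdom2_int i j : Integrable (fun w => h₂ i j w / c + H i j w / c ^ 2) P :=
    ((h₂_int i j).div_const _).add ((hH_int i j).div_const _)
  have hβs_mem : βs ∈ Metric.ball βs r := Metric.mem_ball_self hr
  have hscore_int i j : Integrable (fun w => BitLDP.score ε l u fX Fm βs i w *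
      BitLDP.score ε l u fX Fm βs j w) P := by
    refine ((hH_int i j).div_const (c ^ 2)).mono'
      ((hmeas1 i βs hβs_int).mul (hmeas1 j βs hβs_int)).aestronglyMeasurable
      (ae_of_all _ fun w => ?_)
    rw [Real.norm_eq_abs, abs_mul]
    calc _ ≤ (|BitLDP.pderiv i (fun b => BitLDP.Lam ε l u Fm b w.1) βs| / c) *
          (|BitLDP.pderiv j (fun b => BitLDP.Lam ε l u Fm b w.1) βs| / c) := by
          gcongr
          · exact hbound1 i βs hβs_int w
          · exact hbound1 j βs hβs_int w
      _ = |BitLDP.pderiv i (fun b => BitLDP.Lam ε l u Fm b w.1) βs| *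
          |BitLDP.pderiv j (fun b => BitLDP.Lam ε l u Fm b w.1) βs| / c ^ 2 := by ring
      _ ≤ H i j w / c ^ 2 := by
          gcongr
          exact hprod i j βs hβs_mem w
  refine ⟨fun i j => (hdom2_int i j).mono' (hmeas2 i j).aestronglyMeasurable
    (ae_of_all _ fun w => hbound2 i j βs hβs_mem w), hscore_int, ?_⟩
  have hπ : Measurable fun w : 𝒳 × 𝒴 × Bool => (w.1, w.2.2) := by fun_prop
  have hlaw i : HasLaw (fun ω => (X i ω, Z i ω)) P Pr :=
    (⟨hπ.aemeasurable, rfl⟩ : HasLaw _ P (BitLDP.userLaw ε l u FX F)).fun_comp (h_law i)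
  have hindep : iIndepFun (fun i ω => (X i ω, Z i ω)) Pr :=
    h_indep.comp (fun _ w => (w.1, w.2.2)) fun _ => hπ
  exact BitLDP.asymptoticNormality_argmax hlaw hindep h𝓑 hr (hball_r.trans hsub)
    (m := BitLDP.logDensity ε l u fX Fm) hm_meas
    (fun w => BitLDP.continuousOn_logDensity (fun β hβ => hc0.trans_le (hpos _ _ β hβ))
      (BitLDP.continuousOn_bitProb hε hlu hFm hfm_meas hfm hfm_cont w.2 w.1))
    ((integrable_const (Real.log (Real.exp ε + 1))).add hfX_log'.abs)
    (fun β hβ w => by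
      have := hFm β hβ
      exact BitLDP.abs_logDensity_le hε hlu w)
    hβs_max (fun w => (hm_C2 w).mono hball_r)
    (fun j => ⟨fun w => h₁ j w / c, (h₁_int j).div_const c, fun β hβ w =>
      (hbound1 j β (hball_r hβ) w).trans
        (div_le_div_of_nonneg_right (h₁_dom j β (hball_r hβ) w) hc0.le)⟩)
    (fun i j => ⟨_, hdom2_int i j, hbound2 i j⟩)
    (fun i j => rfl) hA hscore_int (fun i j => rfl) hβhat_meas hβhat
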